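/- Let $K$ be a field and let $A=A_0\oplus A_1$ be a $\mathbf Z_2$-graded unital associative $K$-algebra (the ordinary, non-super case is $A_1=0$). Write $[a]\in\mathbf Z_2$ for the degree of a homogeneous $a$. Tensor powers of $A$ carry the product $(a\otimes b)(a'\otimes b')=(-1)^{[b][a']}aa'\otimes bb'$ and the total grading, and $T(a\otimes b)=(-1)^{[a][b]}b\otimes a$. A *quasi-Hopf (super)algebra* structure on $A$ consists of grading-preserving algebra homomorphisms $\epsilon:A\to K$ and $\Delta:A\to A\otimes A$, an invertible homogeneous $\Phi=\sum_\nu X_\nu\otimes Y_\nu\otimes Z_\nu\in A^{\otimes 3}$ with $\Phi^{-1}=\sum_\nu\bar X_\nu\otimes\bar Y_\nu\otimes\bar Z_\nu$, a grading-preserving linear map $S:A\to A$ with $S(1)=1$ and $S(ab)=(-1)^{[a][b]}S(b)S(a)$ for homogeneous $a,b$, and homogeneous $\alpha,\beta\in A$, such that for all $a\in A$, with $\Delta(a)=\sum a_{(1)}\otimes a_{(2)}$, $$(1\otimes\Delta)\Delta(a)=\Phi^{-1}\,(\Delta\otimes1)\Delta(a)\,\Phi,\qquad (\Delta\otimes1\otimes1)\Phi\cdot(1\otimes1\otimes\Delta)\Phi=(\Phi\otimes1)\cdot(1\otimes\Delta\otimes1)\Phi\cdot(1\otimes\Phi),$$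 $$(\epsilon\otimes1)\Delta=1=(1\otimes\epsilon)\Delta,\qquad(1\otimes\epsilon\otimes1)\Phi=1,$$ $$\sum S(a_{(1)})\alpha a_{(2)}=\epsilon(a)\alpha,\qquad\sum a_{(1)}\beta S(a_{(2)})=\epsilon(a)\beta,$$ $$\sum_\nu\bar X_\nu\beta S(\bar Y_\nu)\alpha\bar Z_\nu=1,\qquad\sum_\nu S(X_\nu)\alpha Y_\nu\beta S(Z_\nu)=1.$$ It is *quasi-triangular* with universal R-matrix $\mathcal R=\sum_i e_i\otimes e^i$ if $\mathcal R\in A\otimes A$ is invertible and homogeneous and $$T(\Delta(a))\,\mathcal R=\mathcal R\,\Delta(a)\ \ (a\in A),\qquad(\Delta\otimes1)\mathcal R=\Phi_{231}^{-1}\mathcal R_{13}\Phi_{132}\mathcal R_{23}\Phi^{-1},\qquad(1\otimes\Delta)\mathcal R=\Phi_{312}\mathcal R_{13}\Phi_{213}^{-1}\mathcal R_{12}\Phi,$$ where $\mathcal R_{12}=\mathcal R\otimes1$, $\mathcal R_{23}=1\otimes\mathcal R$, $\mathcal R_{13}=(1\otimes T)\mathcal R_{12}$, $\Phi_{132}=(1\otimes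 T)\Phi$, $\Phi_{312}=(T\otimes1)(1\otimes T)\Phi$, $\Phi^{-1}_{213}=(T\otimes1)\Phi^{-1}$, $\Phi^{-1}_{231}=(1\otimes T)(T\otimes1)\Phi^{-1}$. **Claim.** Let $A$ be a quasi-triangular quasi-Hopf (super)algebra and put (for expansions of $\Phi$ and $\mathcal R$ into homogeneous tensors) $$u=\sum_{\nu,i}(-1)^{[e_i]+[X_\nu]}\,S\big(Y_\nu\beta S(Z_\nu)\big)\,S(e^i)\,\alpha\, e_i\,X_\nu .$$ Then $$S(u)\,S(\beta)=\sum_i e_i\,\beta\,S(e^i),$$ that is, $S(u)S(\beta)$ is the image of $\mathcal R$ under the linear map $A\otimes A\to A$, $a\otimes b\mapsto a\beta S(b)$. -/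

import Mathlib

open scoped TensorProduct

noncomputable section

namespace SuperTensor

open GradedTensorProduct

section Grading

variable {K A B : Type*} [Field K] [Ring A] [Ring B] [Algebra K A] [Algebra K B]
variable (𝒜 : ZMod 2 → Submodule K A) (ℬ : ZMod 2 → Submodule K B)
variable [GradedAlgebra 𝒜] [GradedAlgebra ℬ]

/-- The total grading on the graded tensor product: the piece of degree `n` is spanned by the
tensors `a ⊗ b` with `a`, `b` homogeneous and `[a] + [b] = n`. -/
def grading (n : ZMod 2) : Submodule K (𝒜 ᵍ⊗[K] ℬ) :=
  Submodule.span K {x | ∃ i j : ZMod 2, i + j = n ∧ ∃ a ∈ 𝒜 i, ∃ b ∈ ℬ j, x = a ᵍ⊗ₜ[K] b}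

theorem tmul_mem_grading {i j : ZMod 2} {a : A} {b : B} (ha : a ∈ 𝒜 i) (hb : b ∈ ℬ j) :
    (a ᵍ⊗ₜ[K] b : 𝒜 ᵍ⊗[K] ℬ) ∈ grading 𝒜 ℬ (i + j) :=
  Submodule.subset_span ⟨i, j, rfl, a, ha, b, hb, rfl⟩

theorem map_proj_mem_grading (i j : ZMod 2) (x : A ⊗[K] B) :
    of K 𝒜 ℬ (TensorProduct.map (GradedAlgebra.proj 𝒜 i) (GradedAlgebra.proj ℬ j) x) ∈
      grading 𝒜 ℬ (i + j) := by
  induction x using TensorProduct.induction_on with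
  | zero => simp
  | tmul a b =>
    exact tmul_mem_grading 𝒜 ℬ (SetLike.coe_mem (DirectSum.decompose 𝒜 a i))
      (SetLike.coe_mem (DirectSum.decompose ℬ b j))
  | add x y hx hy => rw [map_add, map_add]; exact add_mem hx hy

/-- The part of bidegree `(i, j)` of a tensor, as an element of total degree `i + j`. -/
def bidegreePart (i j : ZMod 2) : 𝒜 ᵍ⊗[K] ℬ →ₗ[K] grading 𝒜 ℬ (i + j) :=
  LinearMap.codRestrict (grading 𝒜 ℬ (i + j))
    ((of K 𝒜 ℬ).toLinearMap ∘ₗ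
      TensorProduct.map (GradedAlgebra.proj 𝒜 i) (GradedAlgebra.proj ℬ j) ∘ₗ
        (of K 𝒜 ℬ).symm.toLinearMap)
    (fun x => map_proj_mem_grading 𝒜 ℬ i j ((of K 𝒜 ℬ).symm x))

/-- The decomposition of a tensor into its parts of degree `0` and `1`. -/
def decomp : 𝒜 ᵍ⊗[K] ℬ →ₗ[K] DirectSum (ZMod 2) (fun n => grading 𝒜 ℬ n) :=
  ∑ i : ZMod 2, ∑ j : ZMod 2,
    DirectSum.lof K (ZMod 2) (fun n => grading 𝒜 ℬ n) (i + j) ∘ₗ bidegreePart 𝒜 ℬ i j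

theorem sum_proj (a : A) : ∑ i : ZMod 2, GradedAlgebra.proj 𝒜 i a = a := by
  classical
  conv_rhs => rw [← DirectSum.sum_support_decompose 𝒜 a]
  refine (Finset.sum_subset (Finset.subset_univ _) fun i _ hi => ?_).symm
  simpa using hi

theorem proj_of_mem {i : ZMod 2} {a : A} (ha : a ∈ 𝒜 i) : GradedAlgebra.proj 𝒜 i a = a := by
  rw [GradedAlgebra.proj_apply, DirectSum.decompose_of_mem_same 𝒜 ha]

theorem proj_of_mem_ne {i j : ZMod 2} {a : A} (ha : a ∈ 𝒜 i) (hij : i ≠ j) :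
    GradedAlgebra.proj 𝒜 j a = 0 := by
  rw [GradedAlgebra.proj_apply, DirectSum.decompose_of_mem_ne 𝒜 ha hij]

theorem coe_bidegreePart_tmul (i j : ZMod 2) (a : A) (b : B) :
    (bidegreePart 𝒜 ℬ i j (a ᵍ⊗ₜ[K] b) : 𝒜 ᵍ⊗[K] ℬ) =
      (GradedAlgebra.proj 𝒜 i a) ᵍ⊗ₜ[K] (GradedAlgebra.proj ℬ j b) :=
  rfl

theorem decomp_apply (x : 𝒜 ᵍ⊗[K] ℬ) :
    decomp 𝒜 ℬ x = ∑ i : ZMod 2, ∑ j : ZMod 2,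
      DirectSum.lof K (ZMod 2) (fun n => grading 𝒜 ℬ n) (i + j) (bidegreePart 𝒜 ℬ i j x) := by
  simp [decomp, LinearMap.sum_apply]

theorem coe_decomp (x : 𝒜 ᵍ⊗[K] ℬ) :
    DirectSum.coeLinearMap (grading 𝒜 ℬ) (decomp 𝒜 ℬ x) = x := by
  obtain ⟨y, rfl⟩ := (of K 𝒜 ℬ).surjective x
  induction y using TensorProduct.induction_on with
  | zero => simp
  | tmul a b =>
    simp only [decomp_apply, map_sum, DirectSum.coeLinearMap_lof, coe_bidegreePart_tmul]
    simp only [← map_sum, ← TensorProduct.tmul_sum, ← TensorProduct.sum_tmul, sum_proj]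
  | add x y hx hy => rw [map_add, map_add, map_add, hx, hy]

theorem decomp_of_mem {n : ZMod 2} {x : 𝒜 ᵍ⊗[K] ℬ} (hx : x ∈ grading 𝒜 ℬ n) :
    decomp 𝒜 ℬ x = DirectSum.lof K (ZMod 2) (fun n => grading 𝒜 ℬ n) n ⟨x, hx⟩ := by
  induction hx using Submodule.span_induction with
  | mem x h =>
    obtain ⟨i, j, rfl, a, ha, b, hb, rfl⟩ := h
    rw [decomp_apply, Finset.sum_eq_single i, Finset.sum_eq_single j]
    · congr 1
      apply Subtype.ext
      rw [coe_bidegreePart_tmul, proj_of_mem 𝒜 ha, proj_of_mem ℬ hb]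
    · intro j' _ hj
      have h0 : bidegreePart 𝒜 ℬ i j' (a ᵍ⊗ₜ[K] b) = 0 := by
        apply Subtype.ext
        rw [coe_bidegreePart_tmul, proj_of_mem_ne ℬ hb hj.symm]
        simp
      rw [h0, map_zero]
    · simp
    · intro i' _ hi
      refine Finset.sum_eq_zero fun j' _ => ?_
      have h0 : bidegreePart 𝒜 ℬ i' j' (a ᵍ⊗ₜ[K] b) = 0 := by
        apply Subtype.ext
        rw [coe_bidegreePart_tmul, proj_of_mem_ne 𝒜 ha hi.symm]
        simp
      rw [h0, map_zero]
    · simp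
  | zero => rw [map_zero]; exact (map_zero _).symm
  | add x y hx hy ihx ihy => rw [map_add, ihx, ihy, ← map_add]; rfl
  | smul c x hx ih => rw [map_smul, ih, ← map_smul]; rfl

theorem mul_mem_grading {m n : ZMod 2} {x y : 𝒜 ᵍ⊗[K] ℬ} (hx : x ∈ grading 𝒜 ℬ m)
    (hy : y ∈ grading 𝒜 ℬ n) : x * y ∈ grading 𝒜 ℬ (m + n) := by
  induction hx using Submodule.span_induction with
  | mem x h =>
    obtain ⟨i, j, rfl, a, ha, b, hb, rfl⟩ := h
    induction hy using Submodule.span_induction with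
    | mem y h =>
      obtain ⟨i', j', rfl, a', ha', b', hb', rfl⟩ := h
      have h1 := tmul_coe_mul_coe_tmul (R := K) 𝒜 ℬ a ⟨b, hb⟩ ⟨a', ha'⟩ b'
      have h2 := tmul_mem_grading 𝒜 ℬ (SetLike.mul_mem_graded ha ha')
        (SetLike.mul_mem_graded hb hb')
      rw [add_add_add_comm] at h2
      simp only at h1
      rw [h1]
      rcases Int.units_eq_one_or ((-1 : ℤˣ) ^ (j * i')) with h | h <;> rw [h]
      · simpa using h2
      · rw [Units.neg_smul, one_smul]; exact neg_mem h2
    | zero => rw [mul_zero]; exact zero_mem _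
    | add x y hx hy ihx ihy => rw [mul_add]; exact add_mem ihx ihy
    | smul c x hx ih => rw [mul_smul_comm]; exact Submodule.smul_mem _ _ ih
  | zero => rw [zero_mul]; exact zero_mem _
  | add x y hx hy ihx ihy => rw [add_mul]; exact add_mem ihx ihy
  | smul c x hx ih => rw [smul_mul_assoc]; exact Submodule.smul_mem _ _ ih

instance gradedAlgebra : GradedAlgebra (grading 𝒜 ℬ) where
  one_mem := by
    have h := tmul_mem_grading 𝒜 ℬ (SetLike.GradedOne.one_mem (A := 𝒜))
      (SetLike.GradedOne.one_mem (A := ℬ))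
    rwa [add_zero] at h
  mul_mem _ _ _ _ hx hy := mul_mem_grading 𝒜 ℬ hx hy
  toDecomposition := DirectSum.Decomposition.ofLinearMap _ (decomp 𝒜 ℬ)
    (LinearMap.ext fun x => coe_decomp 𝒜 ℬ x)
    (DirectSum.linearMap_ext K fun n => LinearMap.ext fun x => by
      simpa using decomp_of_mem 𝒜 ℬ x.2)

end Grading

section Maps

variable {K A B C A' B' : Type*} [Field K] [Ring A] [Ring B] [Ring C] [Ring A'] [Ring B']
variable [Algebra K A] [Algebra K B] [Algebra K C] [Algebra K A'] [Algebra K B']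
variable (𝒜 : ZMod 2 → Submodule K A) (ℬ : ZMod 2 → Submodule K B) (𝒞 : ZMod 2 → Submodule K C)
variable (𝒜' : ZMod 2 → Submodule K A') (ℬ' : ZMod 2 → Submodule K B')
variable [GradedAlgebra 𝒜] [GradedAlgebra ℬ] [GradedAlgebra 𝒞]
variable [GradedAlgebra 𝒜'] [GradedAlgebra ℬ']

/-- `f ⊗ g` for (even) linear maps: `a ⊗ b ↦ f a ⊗ g b`. -/
def map (f : A →ₗ[K] A') (g : B →ₗ[K] B') : 𝒜 ᵍ⊗[K] ℬ →ₗ[K] 𝒜' ᵍ⊗[K] ℬ' :=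
  (of K 𝒜' ℬ').toLinearMap ∘ₗ TensorProduct.map f g ∘ₗ (of K 𝒜 ℬ).symm.toLinearMap

/-- The reassociation `(a ⊗ b) ⊗ c ↦ a ⊗ (b ⊗ c)`. -/
def assoc : grading 𝒜 ℬ ᵍ⊗[K] 𝒞 ≃ₗ[K] 𝒜 ᵍ⊗[K] grading ℬ 𝒞 :=
  (of K (grading 𝒜 ℬ) 𝒞).symm ≪≫ₗ
    TensorProduct.congr (of K 𝒜 ℬ).symm (LinearEquiv.refl K C) ≪≫ₗ
      TensorProduct.assoc K A B C ≪≫ₗ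
        TensorProduct.congr (LinearEquiv.refl K A) (of K ℬ 𝒞) ≪≫ₗ of K 𝒜 (grading ℬ 𝒞)

/-- `a ⊗ b ↦ f a * g b`. -/
def contract (f : A →ₗ[K] C) (g : B →ₗ[K] C) : 𝒜 ᵍ⊗[K] ℬ →ₗ[K] C :=
  LinearMap.mul' K C ∘ₗ TensorProduct.map f g ∘ₗ (of K 𝒜 ℬ).symm.toLinearMap

/-- `a ⊗ b ↦ g b * f a`, without a sign. -/
def contractOp (f : A →ₗ[K] C) (g : B →ₗ[K] C) : 𝒜 ᵍ⊗[K] ℬ →ₗ[K] C :=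
  LinearMap.mul' K C ∘ₗ (TensorProduct.comm K C C).toLinearMap ∘ₗ TensorProduct.map f g ∘ₗ
    (of K 𝒜 ℬ).symm.toLinearMap

/-- `e ⊗ 1`, that is `a ⊗ b ↦ e(a) b`, for a linear form `e`. -/
def formLeft (e : A →ₗ[K] K) : 𝒜 ᵍ⊗[K] ℬ →ₗ[K] B :=
  (TensorProduct.lid K B).toLinearMap ∘ₗ TensorProduct.map e LinearMap.id ∘ₗ
    (of K 𝒜 ℬ).symm.toLinearMap

/-- `1 ⊗ e`, that is `a ⊗ b ↦ e(b) a`, for a linear form `e`. -/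
def formRight (e : B →ₗ[K] K) : 𝒜 ᵍ⊗[K] ℬ →ₗ[K] A :=
  (TensorProduct.rid K A).toLinearMap ∘ₗ TensorProduct.map LinearMap.id e ∘ₗ
    (of K 𝒜 ℬ).symm.toLinearMap

@[simp] theorem map_tmul (f : A →ₗ[K] A') (g : B →ₗ[K] B') (a : A) (b : B) :
    map 𝒜 ℬ 𝒜' ℬ' f g (a ᵍ⊗ₜ[K] b) = f a ᵍ⊗ₜ[K] g b := rfl

@[simp] theorem assoc_tmul (a : A) (b : B) (c : C) :
    assoc 𝒜 ℬ 𝒞 ((a ᵍ⊗ₜ[K] b) ᵍ⊗ₜ[K] c) = a ᵍ⊗ₜ[K] (b ᵍ⊗ₜ[K] c) := rfl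

@[simp] theorem contract_tmul (f : A →ₗ[K] C) (g : B →ₗ[K] C) (a : A) (b : B) :
    contract 𝒜 ℬ f g (a ᵍ⊗ₜ[K] b) = f a * g b := rfl

@[simp] theorem contractOp_tmul (f : A →ₗ[K] C) (g : B →ₗ[K] C) (a : A) (b : B) :
    contractOp 𝒜 ℬ f g (a ᵍ⊗ₜ[K] b) = g b * f a := rfl

@[simp] theorem formLeft_tmul (e : A →ₗ[K] K) (a : A) (b : B) :
    formLeft 𝒜 ℬ e (a ᵍ⊗ₜ[K] b) = e a • b := rfl

@[simp] theorem formRight_tmul (e : B →ₗ[K] K) (a : A) (b : B) :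
    formRight 𝒜 ℬ e (a ᵍ⊗ₜ[K] b) = e b • a := rfl

end Maps

section Powers

variable {K A : Type*} [Field K] [Ring A] [Algebra K A]
variable (𝒜 : ZMod 2 → Submodule K A) [GradedAlgebra 𝒜]

/-- The total grading of `A ⊗ A`. -/
abbrev grading₂ : ZMod 2 → Submodule K (𝒜 ᵍ⊗[K] 𝒜) := grading 𝒜 𝒜

/-- The total grading of `A ⊗ A ⊗ A = A ⊗ (A ⊗ A)`. -/
abbrev grading₃ : ZMod 2 → Submodule K (𝒜 ᵍ⊗[K] grading₂ 𝒜) := grading 𝒜 (grading₂ 𝒜)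

/-- `A ⊗ A` with the product `(a ⊗ b)(a' ⊗ b') = (-1)^([b][a']) aa' ⊗ bb'`. -/
abbrev Tensor₂ : Type _ := 𝒜 ᵍ⊗[K] 𝒜

/-- The graded algebra `A ⊗ A ⊗ A`, bracketed as `A ⊗ (A ⊗ A)`. -/
abbrev Tensor₃ : Type _ := 𝒜 ᵍ⊗[K] grading₂ 𝒜

/-- The graded algebra `A ⊗ A ⊗ A ⊗ A`, bracketed as `A ⊗ (A ⊗ (A ⊗ A))`. -/
abbrev Tensor₄ : Type _ := 𝒜 ᵍ⊗[K] grading₃ 𝒜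

/-- The graded twist `T(a ⊗ b) = (-1)^([a][b]) b ⊗ a`. -/
def twist : Tensor₂ 𝒜 →ₗ[K] Tensor₂ 𝒜 := (GradedTensorProduct.comm 𝒜 𝒜).toLinearMap

/-- `T ⊗ 1` on `A ⊗ A ⊗ A`. -/
def twist₁₂ : Tensor₃ 𝒜 →ₗ[K] Tensor₃ 𝒜 :=
  (assoc 𝒜 𝒜 𝒜).toLinearMap ∘ₗ
    map (grading₂ 𝒜) 𝒜 (grading₂ 𝒜) 𝒜 (twist 𝒜) LinearMap.id ∘ₗ
      (assoc 𝒜 𝒜 𝒜).symm.toLinearMap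

/-- `1 ⊗ T` on `A ⊗ A ⊗ A`. -/
def twist₂₃ : Tensor₃ 𝒜 →ₗ[K] Tensor₃ 𝒜 :=
  map 𝒜 (grading₂ 𝒜) 𝒜 (grading₂ 𝒜) LinearMap.id (twist 𝒜)

/-- `x ↦ x ⊗ 1` from `A ⊗ A` to `A ⊗ A ⊗ A`. -/
def emb₁₂ (x : Tensor₂ 𝒜) : Tensor₃ 𝒜 := assoc 𝒜 𝒜 𝒜 (x ᵍ⊗ₜ[K] (1 : A))

/-- `x ↦ 1 ⊗ x` from `A ⊗ A` to `A ⊗ A ⊗ A`. -/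
def emb₂₃ (x : Tensor₂ 𝒜) : Tensor₃ 𝒜 := (1 : A) ᵍ⊗ₜ[K] x

/-- `a ⊗ b ↦ a ⊗ 1 ⊗ b` from `A ⊗ A` to `A ⊗ A ⊗ A`. -/
def emb₁₃ (x : Tensor₂ 𝒜) : Tensor₃ 𝒜 := twist₂₃ 𝒜 (emb₁₂ 𝒜 x)

/-- `x ↦ x ⊗ 1` from `A ⊗ A ⊗ A` to `A ⊗ A ⊗ A ⊗ A`. -/
def emb₁₂₃ (x : Tensor₃ 𝒜) : Tensor₄ 𝒜 :=
  map 𝒜 (grading (grading₂ 𝒜) 𝒜) 𝒜 (grading₃ 𝒜) LinearMap.id (assoc 𝒜 𝒜 𝒜).toLinearMap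
    (assoc 𝒜 (grading₂ 𝒜) 𝒜 (x ᵍ⊗ₜ[K] (1 : A)))

/-- `x ↦ 1 ⊗ x` from `A ⊗ A ⊗ A` to `A ⊗ A ⊗ A ⊗ A`. -/
def emb₂₃₄ (x : Tensor₃ 𝒜) : Tensor₄ 𝒜 := (1 : A) ᵍ⊗ₜ[K] x

/-- The linear map with `a ↦ (-1)^[a] a` for homogeneous `a`. -/
def parity : A →ₗ[K] A := GradedAlgebra.proj 𝒜 0 - GradedAlgebra.proj 𝒜 1

section Coproduct

variable (Δ : A →ₗ[K] Tensor₂ 𝒜)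

/-- `Δ ⊗ 1 : A ⊗ A → A ⊗ A ⊗ A`. -/
def comulLeft : Tensor₂ 𝒜 →ₗ[K] Tensor₃ 𝒜 :=
  (assoc 𝒜 𝒜 𝒜).toLinearMap ∘ₗ map 𝒜 𝒜 (grading₂ 𝒜) 𝒜 Δ LinearMap.id

/-- `1 ⊗ Δ : A ⊗ A → A ⊗ A ⊗ A`. -/
def comulRight : Tensor₂ 𝒜 →ₗ[K] Tensor₃ 𝒜 :=
  map 𝒜 𝒜 𝒜 (grading₂ 𝒜) LinearMap.id Δ

/-- `Δ ⊗ 1 ⊗ 1 : A ⊗ A ⊗ A → A ⊗ A ⊗ A ⊗ A`. -/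
def comul₁ : Tensor₃ 𝒜 →ₗ[K] Tensor₄ 𝒜 :=
  (assoc 𝒜 𝒜 (grading₂ 𝒜)).toLinearMap ∘ₗ
    map 𝒜 (grading₂ 𝒜) (grading₂ 𝒜) (grading₂ 𝒜) Δ LinearMap.id

/-- `1 ⊗ Δ ⊗ 1 : A ⊗ A ⊗ A → A ⊗ A ⊗ A ⊗ A`. -/
def comul₂ : Tensor₃ 𝒜 →ₗ[K] Tensor₄ 𝒜 :=
  map 𝒜 (grading₂ 𝒜) 𝒜 (grading₃ 𝒜) LinearMap.id (comulLeft 𝒜 Δ)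

/-- `1 ⊗ 1 ⊗ Δ : A ⊗ A ⊗ A → A ⊗ A ⊗ A ⊗ A`. -/
def comul₃ : Tensor₃ 𝒜 →ₗ[K] Tensor₄ 𝒜 :=
  map 𝒜 (grading₂ 𝒜) 𝒜 (grading₃ 𝒜) LinearMap.id (comulRight 𝒜 Δ)

end Coproduct

section Antipode

variable (S : A →ₗ[K] A)

/-- `a ⊗ b ↦ S(a) c b`. -/
def contractS (c : A) : Tensor₂ 𝒜 →ₗ[K] A := contract 𝒜 𝒜 S (LinearMap.mulLeft K c)

/-- `a ⊗ b ↦ a c S(b)`. -/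
def contractS' (c : A) : Tensor₂ 𝒜 →ₗ[K] A :=
  contract 𝒜 𝒜 LinearMap.id (LinearMap.mulLeft K c ∘ₗ S)

end Antipode

end Powers

end SuperTensor

open SuperTensor

/-- A quasi-Hopf superalgebra structure on the `ℤ/2`-graded unital associative `K`-algebra `A` with
grading `𝒜`. All structure maps preserve the grading. An ordinary quasi-Hopf algebra is the case of
the trivial grading, `𝒜 0 = ⊤` and `𝒜 1 = ⊥`. -/
structure QuasiHopfSuperalgebra {K A : Type*} [Field K] [Ring A] [Algebra K A]
    (𝒜 : ZMod 2 → Submodule K A) [GradedAlgebra 𝒜] where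
  /-- the co-unit -/
  ε : A →ₐ[K] K
  ε_odd : ∀ a ∈ 𝒜 1, ε a = 0
  /-- the co-product -/
  Δ : A →ₐ[K] Tensor₂ 𝒜
  Δ_mem : ∀ i, ∀ a ∈ 𝒜 i, Δ a ∈ grading₂ 𝒜 i
  /-- the co-associator, an invertible element of `A ⊗ A ⊗ A` -/
  Φ : (Tensor₃ 𝒜)ˣ
  Φ_homogeneous : SetLike.IsHomogeneousElem (grading₃ 𝒜) (Φ : Tensor₃ 𝒜)
  /-- the antipode, a graded algebra anti-homomorphism -/
  S : A →ₗ[K] A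
  S_mem : ∀ i, ∀ a ∈ 𝒜 i, S a ∈ 𝒜 i
  S_one : S 1 = 1
  S_mul : ∀ i j, ∀ a ∈ 𝒜 i, ∀ b ∈ 𝒜 j, S (a * b) = (-1 : ℤˣ) ^ (i * j) • (S b * S a)
  /-- the first canonical element -/
  α : A
  α_homogeneous : SetLike.IsHomogeneousElem 𝒜 α
  /-- the second canonical element -/
  β : A
  β_homogeneous : SetLike.IsHomogeneousElem 𝒜 β
  /-- `(1 ⊗ Δ)Δ(a) = Φ⁻¹ (Δ ⊗ 1)Δ(a) Φ` -/
  quasi_coassoc : ∀ a, comulRight 𝒜 Δ.toLinearMap (Δ a) =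
    (↑Φ⁻¹ : Tensor₃ 𝒜) * comulLeft 𝒜 Δ.toLinearMap (Δ a) * (Φ : Tensor₃ 𝒜)
  /-- `(Δ ⊗ 1 ⊗ 1)Φ · (1 ⊗ 1 ⊗ Δ)Φ = (Φ ⊗ 1) · (1 ⊗ Δ ⊗ 1)Φ · (1 ⊗ Φ)` -/
  pentagon : comul₁ 𝒜 Δ.toLinearMap (Φ : Tensor₃ 𝒜) * comul₃ 𝒜 Δ.toLinearMap (Φ : Tensor₃ 𝒜) =
    emb₁₂₃ 𝒜 (Φ : Tensor₃ 𝒜) * comul₂ 𝒜 Δ.toLinearMap (Φ : Tensor₃ 𝒜) *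
      emb₂₃₄ 𝒜 (Φ : Tensor₃ 𝒜)
  /-- `(ε ⊗ 1)Δ = 1` -/
  counit_left : ∀ a, formLeft 𝒜 𝒜 ε.toLinearMap (Δ a) = a
  /-- `(1 ⊗ ε)Δ = 1` -/
  counit_right : ∀ a, formRight 𝒜 𝒜 ε.toLinearMap (Δ a) = a
  /-- `(1 ⊗ ε ⊗ 1)Φ = 1` -/
  counit_Φ : map 𝒜 (grading₂ 𝒜) 𝒜 𝒜 LinearMap.id (formLeft 𝒜 𝒜 ε.toLinearMap)
    (Φ : Tensor₃ 𝒜) = 1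
  /-- `∑ S(a₍₁₎) α a₍₂₎ = ε(a) α` -/
  antipode_α : ∀ a, contractS 𝒜 S α (Δ a) = ε a • α
  /-- `∑ a₍₁₎ β S(a₍₂₎) = ε(a) β` -/
  antipode_β : ∀ a, contractS' 𝒜 S β (Δ a) = ε a • β
  /-- `∑ X̄ β S(Ȳ) α Z̄ = 1`, where `Φ⁻¹ = ∑ X̄ ⊗ Ȳ ⊗ Z̄` -/
  antipode_Φ_inv : contract 𝒜 (grading₂ 𝒜) (LinearMap.mulRight K β) (contractS 𝒜 S α)
    (↑Φ⁻¹ : Tensor₃ 𝒜) = 1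
  /-- `∑ S(X) α Y β S(Z) = 1`, where `Φ = ∑ X ⊗ Y ⊗ Z` -/
  antipode_Φ : contract 𝒜 (grading₂ 𝒜) (LinearMap.mulRight K α ∘ₗ S) (contractS' 𝒜 S β)
    (Φ : Tensor₃ 𝒜) = 1

namespace QuasiHopfSuperalgebra

variable {K A : Type*} [Field K] [Ring A] [Algebra K A]
variable {𝒜 : ZMod 2 → Submodule K A} [GradedAlgebra 𝒜]

/-- `R` is a universal R-matrix, making the quasi-Hopf superalgebra quasi-triangular. The leg
permutations of `Φ = ∑ X ⊗ Y ⊗ Z` are, up to the sign of the graded twist,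
`Φ₁₃₂ = X ⊗ Z ⊗ Y`, `Φ₂₁₃ = Y ⊗ X ⊗ Z`, `Φ₂₃₁ = Y ⊗ Z ⊗ X` and `Φ₃₁₂ = Z ⊗ X ⊗ Y`. -/
structure IsUniversalRMatrix (H : QuasiHopfSuperalgebra 𝒜) (R : (Tensor₂ 𝒜)ˣ) : Prop where
  homogeneous : SetLike.IsHomogeneousElem (grading₂ 𝒜) (R : Tensor₂ 𝒜)
  /-- `Δᵀ(a) R = R Δ(a)` -/
  intertwine : ∀ a, twist 𝒜 (H.Δ a) * (R : Tensor₂ 𝒜) = (R : Tensor₂ 𝒜) * H.Δ a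
  /-- `(Δ ⊗ 1)R = Φ₂₃₁⁻¹ R₁₃ Φ₁₃₂ R₂₃ Φ₁₂₃⁻¹` -/
  hexagon_left : comulLeft 𝒜 H.Δ.toLinearMap (R : Tensor₂ 𝒜) =
    twist₂₃ 𝒜 (twist₁₂ 𝒜 (↑H.Φ⁻¹ : Tensor₃ 𝒜)) * emb₁₃ 𝒜 (R : Tensor₂ 𝒜) *
      twist₂₃ 𝒜 (H.Φ : Tensor₃ 𝒜) * emb₂₃ 𝒜 (R : Tensor₂ 𝒜) * (↑H.Φ⁻¹ : Tensor₃ 𝒜)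
  /-- `(1 ⊗ Δ)R = Φ₃₁₂ R₁₃ Φ₂₁₃⁻¹ R₁₂ Φ₁₂₃` -/
  hexagon_right : comulRight 𝒜 H.Δ.toLinearMap (R : Tensor₂ 𝒜) =
    twist₁₂ 𝒜 (twist₂₃ 𝒜 (H.Φ : Tensor₃ 𝒜)) * emb₁₃ 𝒜 (R : Tensor₂ 𝒜) *
      twist₁₂ 𝒜 (↑H.Φ⁻¹ : Tensor₃ 𝒜) * emb₁₂ 𝒜 (R : Tensor₂ 𝒜) * (H.Φ : Tensor₃ 𝒜)

/-- `∑ (-1)^[eᵢ] S(eⁱ) α eᵢ`, where `R = ∑ eᵢ ⊗ eⁱ`. -/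
def uCore (H : QuasiHopfSuperalgebra 𝒜) (R : (Tensor₂ 𝒜)ˣ) : A :=
  contractOp 𝒜 𝒜 (LinearMap.mulLeft K H.α ∘ₗ parity 𝒜) H.S (R : Tensor₂ 𝒜)

/-- The `u`-operator `u = ∑ (-1)^([eᵢ] + [X]) S(Y β S(Z)) S(eⁱ) α eᵢ X`, where
`Φ = ∑ X ⊗ Y ⊗ Z` and `R = ∑ eᵢ ⊗ eⁱ`. -/
def u (H : QuasiHopfSuperalgebra 𝒜) (R : (Tensor₂ 𝒜)ˣ) : A :=
  contractOp 𝒜 (grading₂ 𝒜) (LinearMap.mulLeft K (H.uCore R) ∘ₗ parity 𝒜)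
    (H.S ∘ₗ contractS' 𝒜 H.S H.β) (H.Φ : Tensor₃ 𝒜)

end QuasiHopfSuperalgebra

end

/-! Put n = ∑ eᵢ β S(eⁱ). The claim follows from S(n) = uβ by cancelling one S, so two things are
needed: that identity, and injectivity of S, which is not among the axioms.

The computations take place among operators on A ⊗ A, with four supercommuting actions P, Q, Q', P'
of A (`legP`, `legQ`, `legQ'`, `legP'`): left multiplication by a, or right multiplication by S(a),
on either factor. Evaluating Φ and R on such "legs" turns the pentagon, the hexagons and
quasi-coassociativity into equations between operators, in which no Koszul signs appear. Let G(T) =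
`evalα` (T(β ⊗ β)), where `evalα` sends q ⊗ x to S(q) α x. The axioms for β let G replace a
coproduct on (Q, Q') or (P, P') at the right end of an operator by the counit; the axiom for α does
so for (Q, P) at the left end. Any Φ or R with such a coproduct in one slot can therefore be
inserted or deleted under G.

This gives two identities. In `S_contractS'_eq`, G(R_PQ Φ_PQQ') = G(R_P'Q' Φ_QPP') reads uβ = S(n).
In `exists_mul_contractS'_eq`, G(R⁻¹_QP Φ_PQQ' R_PP') = G(Φ_QPP') reads wn = S(β), where w is built
like u from the inverse of the opposite R-matrix. By `S_S_mul_evalAt`, S²(a)u = ua and S²(a)w = wa.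

Applying S to ∑ S(X) α Y β S(Z) = 1 and substituting S(β) = wn shows that 1 lies in wA
(`exists_mul_eq_one`). Hence w is invertible, S²(a) = w a w⁻¹ and S is injective. Since u and w
commute, S(S(u)S(β)) = S²(βu) = S²(β)u = uβ = S(n). -/

noncomputable section

set_option linter.unusedSectionVars false

namespace SuperTensor

open GradedTensorProduct

/-! ### Koszul signs and induction on homogeneous tensors. -/

section Sign

variable {K : Type*} [Field K]

/-- The Koszul sign `(-1)^i` as a scalar. -/
def sgn (K : Type*) [Field K] (i : ZMod 2) : K := (((-1 : ℤˣ) ^ i : ℤˣ) : ℤ)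

theorem unit_smul_eq_sgn {M : Type*} [AddCommGroup M] [Module K M] (i : ZMod 2) (x : M) :
    (-1 : ℤˣ) ^ i • x = sgn K i • x := by
  rw [sgn, Int.cast_smul_eq_zsmul, Units.smul_def]

@[simp] theorem sgn_zero : sgn K 0 = 1 := by simp [sgn]

theorem sgn_one : sgn K 1 = -1 := by simp [sgn]

theorem sgn_mul_sgn (i j : ZMod 2) : sgn K i * sgn K j = sgn K (i + j) := by
  simp [sgn, uzpow_add]

theorem sgn_smul_smul {M : Type*} [AddCommGroup M] [Module K M] (i j : ZMod 2) (x : M) :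
    sgn K i • sgn K j • x = sgn K (i + j) • x := by
  rw [smul_smul, sgn_mul_sgn]

end Sign

section Homogeneous

variable {K A B C : Type*} [Field K] [Ring A] [Ring B] [Algebra K A] [Algebra K B]
variable {𝒜 : ZMod 2 → Submodule K A} {ℬ : ZMod 2 → Submodule K B}
variable [GradedAlgebra 𝒜] [GradedAlgebra ℬ]

theorem homogeneous_induction {P : A → Prop} (hadd : ∀ x y, P x → P y → P (x + y))
    (h : ∀ i, ∀ a ∈ 𝒜 i, P a) (a : A) : P a := by
  rw [← sum_proj 𝒜 a, show ∑ i : ZMod 2, GradedAlgebra.proj 𝒜 i a =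
    GradedAlgebra.proj 𝒜 0 a + GradedAlgebra.proj 𝒜 1 a from Fin.sum_univ_two _]
  exact hadd _ _ (h _ _ (SetLike.coe_mem _)) (h _ _ (SetLike.coe_mem _))

theorem tmul_induction {P : 𝒜 ᵍ⊗[K] ℬ → Prop} (hadd : ∀ x y, P x → P y → P (x + y))
    (h : ∀ a b, P (a ᵍ⊗ₜ[K] b)) (x : 𝒜 ᵍ⊗[K] ℬ) : P x := by
  obtain ⟨y, rfl⟩ := (of K 𝒜 ℬ).surjective x
  induction y using TensorProduct.induction_on with
  | zero =>
    have h0 := h 0 0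
    rwa [tmul, TensorProduct.zero_tmul] at h0
  | tmul a b => exact h a b
  | add x y hx hy => rw [map_add]; exact hadd _ _ hx hy

theorem homogeneous_tmul_induction {P : 𝒜 ᵍ⊗[K] ℬ → Prop}
    (hadd : ∀ x y, P x → P y → P (x + y))
    (h : ∀ i j, ∀ a ∈ 𝒜 i, ∀ b ∈ ℬ j, P (a ᵍ⊗ₜ[K] b)) (x : 𝒜 ᵍ⊗[K] ℬ) : P x := by
  refine tmul_induction hadd (fun a b => ?_) x
  induction a using homogeneous_induction (𝒜 := 𝒜) with
  | hadd x y hx hy =>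
    have : ((x + y) ᵍ⊗ₜ[K] b : 𝒜 ᵍ⊗[K] ℬ) = x ᵍ⊗ₜ[K] b + y ᵍ⊗ₜ[K] b := by
      rw [tmul, TensorProduct.add_tmul, map_add]
    rw [this]; exact hadd _ _ hx hy
  | h i a ha =>
    induction b using homogeneous_induction (𝒜 := ℬ) with
    | hadd x y hx hy =>
      have : (a ᵍ⊗ₜ[K] (x + y) : 𝒜 ᵍ⊗[K] ℬ) = a ᵍ⊗ₜ[K] x + a ᵍ⊗ₜ[K] y := by
        rw [tmul, TensorProduct.tmul_add, map_add]
      rw [this]; exact hadd _ _ hx hy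
    | h j b hb => exact h i j a ha b hb

theorem twist_tmul {i j : ZMod 2} {a b : A} (ha : a ∈ 𝒜 i) (hb : b ∈ 𝒜 j) :
    twist 𝒜 (a ᵍ⊗ₜ[K] b) = sgn K (j * i) • (b ᵍ⊗ₜ[K] a) := by
  rw [← unit_smul_eq_sgn]
  exact comm_coe_tmul_coe 𝒜 𝒜 ⟨a, ha⟩ ⟨b, hb⟩

end Homogeneous

/-! ### Evaluating tensors on supercommuting legs. -/

section Legs

variable {K A B C E : Type*} [Field K] [Ring A] [Ring B] [Ring C] [Ring E]
variable [Algebra K A] [Algebra K B] [Algebra K C] [Algebra K E]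
variable {𝒜 : ZMod 2 → Submodule K A} {ℬ : ZMod 2 → Submodule K B} {𝒞 : ZMod 2 → Submodule K C}
variable [GradedAlgebra 𝒜] [GradedAlgebra ℬ] [GradedAlgebra 𝒞]

/-- `f` and `g` are unital algebra homomorphisms with supercommuting images. They are kept as
linear maps, so that maps out of tensor powers can be formed without proof obligations. -/
structure SuperCommute (𝒜 : ZMod 2 → Submodule K A) (ℬ : ZMod 2 → Submodule K B)
    (f : A →ₗ[K] E) (g : B →ₗ[K] E) : Prop where
  left_one : f 1 = 1
  left_mul : ∀ a b, f (a * b) = f a * f b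
  right_one : g 1 = 1
  right_mul : ∀ a b, g (a * b) = g a * g b
  comm : ∀ i j, ∀ a ∈ 𝒜 i, ∀ b ∈ ℬ j, f a * g b = sgn K (i * j) • (g b * f a)

namespace SuperCommute

variable {f : A →ₗ[K] E} {g : B →ₗ[K] E} {h : C →ₗ[K] E}

theorem symm (hfg : SuperCommute 𝒜 ℬ f g) : SuperCommute ℬ 𝒜 g f where
  left_one := hfg.right_one
  left_mul := hfg.right_mul
  right_one := hfg.left_one
  right_mul := hfg.left_mul
  comm i j a ha b hb := by
    rw [hfg.comm j i b hb a ha, sgn_smul_smul, mul_comm j i, CharTwo.add_self_eq_zero, sgn_zero,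
      one_smul]

theorem contract_one (hfg : SuperCommute 𝒜 ℬ f g) : contract 𝒜 ℬ f g 1 = 1 := by
  have h1 : (1 : 𝒜 ᵍ⊗[K] ℬ) = 1 ᵍ⊗ₜ[K] 1 := rfl
  rw [h1, contract_tmul, hfg.left_one, hfg.right_one, one_mul]

/-- The universal property of the graded tensor product: supercommutation is exactly what makes the
contraction an algebra map. -/
theorem contract_mul (hfg : SuperCommute 𝒜 ℬ f g) (s t : 𝒜 ᵍ⊗[K] ℬ) :
    contract 𝒜 ℬ f g (s * t) = contract 𝒜 ℬ f g s * contract 𝒜 ℬ f g t :=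
  map_mul (lift 𝒜 ℬ (AlgHom.ofLinearMap f hfg.left_one hfg.left_mul)
    (AlgHom.ofLinearMap g hfg.right_one hfg.right_mul) (fun i j a b => by
      rw [unit_smul_eq_sgn (K := K), mul_comm j i]
      exact hfg.comm i j a a.2 b b.2)) s t

/-- Legs can be added one at a time, so contractions of threefold and fourfold tensors are
multiplicative by iteration. -/
theorem contract_right (hfg : SuperCommute 𝒜 ℬ f g) (hfh : SuperCommute 𝒜 𝒞 f h)
    (hgh : SuperCommute ℬ 𝒞 g h) : SuperCommute 𝒜 (grading ℬ 𝒞) f (contract ℬ 𝒞 g h) where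
  left_one := hfg.left_one
  left_mul := hfg.left_mul
  right_one := hgh.contract_one
  right_mul := hgh.contract_mul
  comm i n a ha t ht := by
    induction ht using Submodule.span_induction with
    | mem x hx =>
      obtain ⟨j, k, rfl, b, hb, c, hc, rfl⟩ := hx
      rw [contract_tmul, ← mul_assoc, hfg.comm i j a ha b hb, smul_mul_assoc, mul_assoc,
        hfh.comm i k a ha c hc, mul_smul_comm, sgn_smul_smul, mul_add, mul_assoc]
    | zero => simp
    | add x y _ _ hx hy => simp only [map_add, mul_add, add_mul, smul_add, hx, hy]
    | smul r x _ hx => simp only [map_smul, mul_smul_comm, smul_mul_assoc, hx, smul_comm r]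

theorem commute_of_mem_zero (hfg : SuperCommute 𝒜 ℬ f g) {b : B} (hb : b ∈ ℬ 0) (a : A) :
    f a * g b = g b * f a := by
  induction a using homogeneous_induction (𝒜 := 𝒜) with
  | hadd x y hx hy => simp only [map_add, add_mul, mul_add, hx, hy]
  | h i a ha => rw [hfg.comm i 0 a ha b hb, mul_zero, sgn_zero, one_smul]

end SuperCommute

theorem contract_map {A' B' : Type*} [Ring A'] [Ring B'] [Algebra K A'] [Algebra K B']
    {𝒜' : ZMod 2 → Submodule K A'} {ℬ' : ZMod 2 → Submodule K B'} [GradedAlgebra 𝒜']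
    [GradedAlgebra ℬ'] (φ : A →ₗ[K] A') (ψ : B →ₗ[K] B') (f : A' →ₗ[K] E) (g : B' →ₗ[K] E)
    (t : 𝒜 ᵍ⊗[K] ℬ) :
    contract 𝒜' ℬ' f g (map 𝒜 ℬ 𝒜' ℬ' φ ψ t) = contract 𝒜 ℬ (f ∘ₗ φ) (g ∘ₗ ψ) t := by
  induction t using tmul_induction with
  | hadd x y hx hy => simp only [map_add, hx, hy]
  | h a b => rfl

theorem contract_assoc (f : A →ₗ[K] E) (g : B →ₗ[K] E) (h : C →ₗ[K] E)
    (t : grading 𝒜 ℬ ᵍ⊗[K] 𝒞) :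
    contract 𝒜 (grading ℬ 𝒞) f (contract ℬ 𝒞 g h) (assoc 𝒜 ℬ 𝒞 t) =
      contract (grading 𝒜 ℬ) 𝒞 (contract 𝒜 ℬ f g) h t := by
  induction t using tmul_induction with
  | hadd x y hx hy => simp only [map_add, hx, hy]
  | h v c =>
    rw [contract_tmul]
    induction v using tmul_induction with
    | hadd x y hx hy =>
      have : ((x + y) ᵍ⊗ₜ[K] c : grading 𝒜 ℬ ᵍ⊗[K] 𝒞) = x ᵍ⊗ₜ[K] c + y ᵍ⊗ₜ[K] c := by
        rw [tmul, TensorProduct.add_tmul, map_add]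
      simp only [this, map_add, add_mul, hx, hy]
    | h a b => rw [assoc_tmul, contract_tmul, contract_tmul, contract_tmul, mul_assoc]

/-- The sign in `twist` is the one produced by exchanging the two legs. Permuting tensor factors
thus becomes permuting legs, with no sign left over. -/
theorem contract_twist {f g : A →ₗ[K] E} (hfg : SuperCommute 𝒜 𝒜 f g) (t : Tensor₂ 𝒜) :
    contract 𝒜 𝒜 f g (twist 𝒜 t) = contract 𝒜 𝒜 g f t := by
  induction t using homogeneous_tmul_induction with
  | hadd x y hx hy => simp only [map_add, hx, hy]
  | h i j a ha b hb =>
    rw [twist_tmul ha hb, map_smul, contract_tmul, contract_tmul, hfg.symm.comm i j a ha b hb,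
      mul_comm]

variable (𝒜) in
/-- `a ⊗ b ⊗ c ↦ f a * (g b * h c)`. -/
def contract₃ (f g h : A →ₗ[K] E) : Tensor₃ 𝒜 →ₗ[K] E :=
  contract 𝒜 (grading₂ 𝒜) f (contract 𝒜 𝒜 g h)

variable (𝒜) in
/-- `a ⊗ b ⊗ c ⊗ d ↦ f a * (g b * (h c * k d))`. -/
def contract₄ (f g h k : A →ₗ[K] E) : Tensor₄ 𝒜 →ₗ[K] E :=
  contract 𝒜 (grading₃ 𝒜) f (contract₃ 𝒜 g h k)

theorem tensor₃_induction {P : Tensor₃ 𝒜 → Prop} (hadd : ∀ x y, P x → P y → P (x + y))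
    (h : ∀ a b c, P (a ᵍ⊗ₜ[K] (b ᵍ⊗ₜ[K] c))) (x : Tensor₃ 𝒜) : P x := by
  refine tmul_induction hadd (fun a v => ?_) x
  induction v using tmul_induction with
  | hadd x y hx hy =>
    have : (a ᵍ⊗ₜ[K] (x + y) : Tensor₃ 𝒜) = a ᵍ⊗ₜ[K] x + a ᵍ⊗ₜ[K] y := by
      rw [tmul, TensorProduct.tmul_add, map_add]
    rw [this]; exact hadd _ _ hx hy
  | h b c => exact h a b c

section

variable {f g h k : A →ₗ[K] E}

theorem contract₃_one (hfg : SuperCommute 𝒜 𝒜 f g) (hfh : SuperCommute 𝒜 𝒜 f h)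
    (hgh : SuperCommute 𝒜 𝒜 g h) : contract₃ 𝒜 f g h 1 = 1 :=
  (hfg.contract_right hfh hgh).contract_one

theorem contract₃_mul (hfg : SuperCommute 𝒜 𝒜 f g) (hfh : SuperCommute 𝒜 𝒜 f h)
    (hgh : SuperCommute 𝒜 𝒜 g h) (s t : Tensor₃ 𝒜) :
    contract₃ 𝒜 f g h (s * t) = contract₃ 𝒜 f g h s * contract₃ 𝒜 f g h t :=
  (hfg.contract_right hfh hgh).contract_mul s t

theorem contract₄_mul (hfg : SuperCommute 𝒜 𝒜 f g) (hfh : SuperCommute 𝒜 𝒜 f h)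
    (hfk : SuperCommute 𝒜 𝒜 f k) (hgh : SuperCommute 𝒜 𝒜 g h) (hgk : SuperCommute 𝒜 𝒜 g k)
    (hhk : SuperCommute 𝒜 𝒜 h k) (s t : Tensor₄ 𝒜) :
    contract₄ 𝒜 f g h k (s * t) = contract₄ 𝒜 f g h k s * contract₄ 𝒜 f g h k t :=
  (hfg.contract_right (hfh.contract_right hfk hhk) (hgh.contract_right hgk hhk)).contract_mul s t

theorem contract₃_twist₁₂ (hfg : SuperCommute 𝒜 𝒜 f g) (t : Tensor₃ 𝒜) :
    contract₃ 𝒜 f g h (twist₁₂ 𝒜 t) = contract₃ 𝒜 g f h t := by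
  obtain ⟨s, rfl⟩ := (assoc 𝒜 𝒜 𝒜).surjective t
  have : contract 𝒜 𝒜 f g ∘ₗ twist 𝒜 = contract 𝒜 𝒜 g f :=
    LinearMap.ext fun t => contract_twist hfg t
  simp only [twist₁₂, contract₃, LinearMap.comp_apply, LinearEquiv.coe_coe,
    LinearEquiv.symm_apply_apply, contract_assoc, contract_map, LinearMap.comp_id, this]

theorem contract₃_twist₂₃ (hgh : SuperCommute 𝒜 𝒜 g h) (t : Tensor₃ 𝒜) :
    contract₃ 𝒜 f g h (twist₂₃ 𝒜 t) = contract₃ 𝒜 f h g t := by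
  have : contract 𝒜 𝒜 g h ∘ₗ twist 𝒜 = contract 𝒜 𝒜 h g :=
    LinearMap.ext fun t => contract_twist hgh t
  simp only [twist₂₃, contract₃, contract_map, LinearMap.comp_id, this]

theorem contract₃_emb₁₂ (hh : h 1 = 1) (t : Tensor₂ 𝒜) :
    contract₃ 𝒜 f g h (emb₁₂ 𝒜 t) = contract 𝒜 𝒜 f g t := by
  rw [emb₁₂, contract₃, contract_assoc, contract_tmul, hh, mul_one]

theorem contract₃_emb₂₃ (hf : f 1 = 1) (t : Tensor₂ 𝒜) :
    contract₃ 𝒜 f g h (emb₂₃ 𝒜 t) = contract 𝒜 𝒜 g h t := by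
  rw [emb₂₃, contract₃, contract_tmul, hf, one_mul]

theorem contract₃_emb₁₃ (hgh : SuperCommute 𝒜 𝒜 g h) (t : Tensor₂ 𝒜) :
    contract₃ 𝒜 f g h (emb₁₃ 𝒜 t) = contract 𝒜 𝒜 f h t := by
  rw [emb₁₃, contract₃_twist₂₃ hgh, contract₃_emb₁₂ hgh.left_one]

theorem contract₄_emb₂₃₄ (hf : f 1 = 1) (t : Tensor₃ 𝒜) :
    contract₄ 𝒜 f g h k (emb₂₃₄ 𝒜 t) = contract₃ 𝒜 g h k t := by
  rw [emb₂₃₄, contract₄, contract_tmul, hf, one_mul]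

theorem contract₄_emb₁₂₃ (hk : k 1 = 1) (t : Tensor₃ 𝒜) :
    contract₄ 𝒜 f g h k (emb₁₂₃ 𝒜 t) = contract₃ 𝒜 f g h t := by
  have : contract₃ 𝒜 g h k ∘ₗ (assoc 𝒜 𝒜 𝒜).toLinearMap =
      contract (grading₂ 𝒜) 𝒜 (contract 𝒜 𝒜 g h) k :=
    LinearMap.ext fun t => contract_assoc g h k t
  rw [emb₁₂₃, contract₄, contract_map, LinearMap.comp_id, this, contract_assoc, contract_tmul, hk,
    mul_one]
  rfl

variable (Δ : A →ₗ[K] Tensor₂ 𝒜)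

theorem contract₃_comulLeft (t : Tensor₂ 𝒜) :
    contract₃ 𝒜 f g h (comulLeft 𝒜 Δ t) = contract 𝒜 𝒜 (contract 𝒜 𝒜 f g ∘ₗ Δ) h t := by
  rw [comulLeft, contract₃, LinearMap.comp_apply, LinearEquiv.coe_coe, contract_assoc,
    contract_map, LinearMap.comp_id]

theorem contract₃_comulRight (t : Tensor₂ 𝒜) :
    contract₃ 𝒜 f g h (comulRight 𝒜 Δ t) = contract 𝒜 𝒜 f (contract 𝒜 𝒜 g h ∘ₗ Δ) t := by
  rw [comulRight, contract₃, contract_map, LinearMap.comp_id]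

theorem contract₄_comul₁ (t : Tensor₃ 𝒜) :
    contract₄ 𝒜 f g h k (comul₁ 𝒜 Δ t) = contract₃ 𝒜 (contract 𝒜 𝒜 f g ∘ₗ Δ) h k t := by
  rw [comul₁, contract₄, LinearMap.comp_apply, LinearEquiv.coe_coe, contract₃, contract_assoc,
    contract_map, LinearMap.comp_id]
  rfl

theorem contract₄_comul₂ (t : Tensor₃ 𝒜) :
    contract₄ 𝒜 f g h k (comul₂ 𝒜 Δ t) = contract₃ 𝒜 f (contract 𝒜 𝒜 g h ∘ₗ Δ) k t := by
  have : contract₃ 𝒜 g h k ∘ₗ comulLeft 𝒜 Δ = contract 𝒜 𝒜 (contract 𝒜 𝒜 g h ∘ₗ Δ) k :=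
    LinearMap.ext fun t => contract₃_comulLeft Δ t
  rw [comul₂, contract₄, contract_map, LinearMap.comp_id, this]
  rfl

theorem contract₄_comul₃ (t : Tensor₃ 𝒜) :
    contract₄ 𝒜 f g h k (comul₃ 𝒜 Δ t) = contract₃ 𝒜 f g (contract 𝒜 𝒜 h k ∘ₗ Δ) t := by
  have : contract₃ 𝒜 g h k ∘ₗ comulRight 𝒜 Δ = contract 𝒜 𝒜 g (contract 𝒜 𝒜 h k ∘ₗ Δ) :=
    LinearMap.ext fun t => contract₃_comulRight Δ t
  rw [comul₃, contract₄, contract_map, LinearMap.comp_id, this]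
  rfl

end

end Legs

end SuperTensor

namespace SuperTensor

open GradedTensorProduct

/-! ### Intertwiners, and replacing a leg under a functional. -/

section Absorption

variable {K A B E N : Type*} [Field K] [Ring A] [Ring B] [Ring E] [AddCommGroup N]
variable [Algebra K A] [Algebra K B] [Algebra K E] [Module K N]
variable {𝒜 : ZMod 2 → Submodule K A} {ℬ : ZMod 2 → Submodule K B}
variable [GradedAlgebra 𝒜] [GradedAlgebra ℬ]
variable {f f' : A →ₗ[K] E} {g g' : B →ₗ[K] E} {G : E →ₗ[K] N}

/-- The sliding rule: what passes each leg separately passes the whole tensor. Typically `W` is R on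
two legs, which flips a coproduct on them and commutes with the other legs. -/
theorem mul_contract_eq {W : E} (hf : ∀ a, W * f a = f' a * W) (hg : ∀ b, W * g b = g' b * W)
    (t : 𝒜 ᵍ⊗[K] ℬ) : W * contract 𝒜 ℬ f g t = contract 𝒜 ℬ f' g' t * W := by
  induction t using tmul_induction with
  | hadd x y hx hy => simp only [map_add, mul_add, add_mul, hx, hy]
  | h a b => rw [contract_tmul, contract_tmul, ← mul_assoc, hf, mul_assoc, hg, mul_assoc]

theorem apply_mul_contract_congr_right (h : ∀ x b, G (x * g b) = G (x * g' b)) (x : E)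
    (t : 𝒜 ᵍ⊗[K] ℬ) : G (x * contract 𝒜 ℬ f g t) = G (x * contract 𝒜 ℬ f g' t) := by
  induction t using tmul_induction with
  | hadd s t hs ht => simp only [map_add, mul_add, hs, ht]
  | h a b => rw [contract_tmul, contract_tmul, ← mul_assoc, h, mul_assoc]

/-- The leg to be replaced is not at the right end; supercommutation brings it there, with the same
sign for `f` and `f'`. -/
theorem apply_mul_contract_congr_left (hfg : SuperCommute 𝒜 ℬ f g) (hfg' : SuperCommute 𝒜 ℬ f' g)
    (h : ∀ x a, G (x * f a) = G (x * f' a)) (x : E) (t : 𝒜 ᵍ⊗[K] ℬ) :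
    G (x * contract 𝒜 ℬ f g t) = G (x * contract 𝒜 ℬ f' g t) := by
  induction t using homogeneous_tmul_induction with
  | hadd s t hs ht => simp only [map_add, mul_add, hs, ht]
  | h i j a ha b hb =>
    rw [contract_tmul, contract_tmul, hfg.comm i j a ha b hb, hfg'.comm i j a ha b hb,
      mul_smul_comm, mul_smul_comm, map_smul, map_smul, ← mul_assoc, h, mul_assoc]

theorem apply_contract_mul_congr_left {c : E} (h : ∀ a x, G (c * f a * x) = G (c * f' a * x))
    (t : 𝒜 ᵍ⊗[K] ℬ) (x : E) :
    G (c * contract 𝒜 ℬ f g t * x) = G (c * contract 𝒜 ℬ f' g t * x) := by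
  induction t using tmul_induction with
  | hadd s t hs ht => simp only [map_add, mul_add, add_mul, hs, ht]
  | h a b => simpa only [contract_tmul, mul_assoc] using h a (g b * x)

end Absorption

end SuperTensor

/-! ### Δ, Φ and R evaluated on legs; counit normalisations and parity. -/

namespace QuasiHopfSuperalgebra

open SuperTensor GradedTensorProduct

variable {K A E : Type*} [Field K] [Ring A] [Algebra K A] [Ring E] [Algebra K E]
variable {𝒜 : ZMod 2 → Submodule K A} [GradedAlgebra 𝒜]
variable (H : QuasiHopfSuperalgebra 𝒜)

/-- `a ↦ ∑ f(a₍₁₎) g(a₍₂₎)`. -/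
def comulLeg (f g : A →ₗ[K] E) : A →ₗ[K] E := contract 𝒜 𝒜 f g ∘ₗ H.Δ.toLinearMap

/-- The co-unit with values in the scalars of an algebra. -/
def counitLeg (E : Type*) [Ring E] [Algebra K E] : A →ₗ[K] E :=
  Algebra.linearMap K E ∘ₗ H.ε.toLinearMap

/-- The image of `Φ` under `a ⊗ b ⊗ c ↦ f(a) g(b) h(c)`. -/
def legΦ (f g h : A →ₗ[K] E) : E := contract₃ 𝒜 f g h (H.Φ : Tensor₃ 𝒜)

/-- The image of `Φ⁻¹` under `a ⊗ b ⊗ c ↦ f(a) g(b) h(c)`. -/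
def legΦInv (f g h : A →ₗ[K] E) : E := contract₃ 𝒜 f g h (↑H.Φ⁻¹ : Tensor₃ 𝒜)

variable {H} {f g h k : A →ₗ[K] E}

theorem counitLeg_apply (a : A) : H.counitLeg E a = algebraMap K E (H.ε a) := rfl

/-- Scalars commute with everything, and the sign does no harm because ε kills odd elements. -/
theorem counitLeg_superCommute (h1 : f 1 = 1) (hmul : ∀ a b, f (a * b) = f a * f b) :
    SuperCommute 𝒜 𝒜 (H.counitLeg E) f where
  left_one := by simp [counitLeg_apply]
  left_mul a b := by simp [counitLeg_apply]
  right_one := h1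
  right_mul := hmul
  comm i j a ha b hb := by
    rw [counitLeg_apply, Algebra.commutes]
    fin_cases i
    · change _ = sgn K (0 * j) • _
      rw [zero_mul, sgn_zero, one_smul]
    · rw [H.ε_odd a ha, map_zero, mul_zero, smul_zero]

theorem SuperCommute.counitLeg_left (hfg : SuperCommute 𝒜 𝒜 f g) :
    SuperCommute 𝒜 𝒜 (H.counitLeg E) f :=
  counitLeg_superCommute hfg.left_one hfg.left_mul

theorem SuperCommute.comulLeg_right (hfg : SuperCommute 𝒜 𝒜 f g) (hfh : SuperCommute 𝒜 𝒜 f h)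
    (hgh : SuperCommute 𝒜 𝒜 g h) : SuperCommute 𝒜 𝒜 f (H.comulLeg g h) where
  left_one := hfg.left_one
  left_mul := hfg.left_mul
  right_one := by
    rw [comulLeg, LinearMap.comp_apply, AlgHom.toLinearMap_apply, map_one, hgh.contract_one]
  right_mul a b := by
    simp only [comulLeg, LinearMap.comp_apply, AlgHom.toLinearMap_apply, map_mul,
      hgh.contract_mul]
  comm i j a ha b hb := (hfg.contract_right hfh hgh).comm i j a ha _ (H.Δ_mem j b hb)

theorem SuperCommute.comulLeg_left (hfg : SuperCommute 𝒜 𝒜 f g) (hfh : SuperCommute 𝒜 𝒜 f h)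
    (hgh : SuperCommute 𝒜 𝒜 g h) : SuperCommute 𝒜 𝒜 (H.comulLeg f g) h :=
  (SuperCommute.comulLeg_right hfh.symm hgh.symm hfg).symm

theorem contract_counitLeg_left (f : A →ₗ[K] E) :
    contract 𝒜 𝒜 (H.counitLeg E) f = f ∘ₗ formLeft 𝒜 𝒜 H.ε.toLinearMap := by
  refine LinearMap.ext fun t => ?_
  induction t using tmul_induction with
  | hadd x y hx hy => simp only [map_add, hx, hy]
  | h a b =>
    rw [contract_tmul, counitLeg_apply, ← Algebra.smul_def, LinearMap.comp_apply, formLeft_tmul,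
      map_smul]
    rfl

theorem contract_counitLeg_right (f : A →ₗ[K] E) :
    contract 𝒜 𝒜 f (H.counitLeg E) = f ∘ₗ formRight 𝒜 𝒜 H.ε.toLinearMap := by
  refine LinearMap.ext fun t => ?_
  induction t using tmul_induction with
  | hadd x y hx hy => simp only [map_add, hx, hy]
  | h a b =>
    rw [contract_tmul, counitLeg_apply, ← Algebra.commutes, ← Algebra.smul_def,
      LinearMap.comp_apply, formRight_tmul, map_smul]
    rfl

theorem comulLeg_counitLeg_left (f : A →ₗ[K] E) : H.comulLeg (H.counitLeg E) f = f := by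
  ext a
  rw [comulLeg, contract_counitLeg_left]
  exact congrArg f (H.counit_left a)

theorem comulLeg_counitLeg_right (f : A →ₗ[K] E) : H.comulLeg f (H.counitLeg E) = f := by
  ext a
  rw [comulLeg, contract_counitLeg_right]
  exact congrArg f (H.counit_right a)

section Associator

theorem legΦ_mul_legΦInv (hfg : SuperCommute 𝒜 𝒜 f g) (hfh : SuperCommute 𝒜 𝒜 f h)
    (hgh : SuperCommute 𝒜 𝒜 g h) : H.legΦ f g h * H.legΦInv f g h = 1 := by
  rw [legΦ, legΦInv, ← contract₃_mul hfg hfh hgh, Units.mul_inv, contract₃_one hfg hfh hgh]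

theorem legΦInv_mul_legΦ (hfg : SuperCommute 𝒜 𝒜 f g) (hfh : SuperCommute 𝒜 𝒜 f h)
    (hgh : SuperCommute 𝒜 𝒜 g h) : H.legΦInv f g h * H.legΦ f g h = 1 := by
  rw [legΦ, legΦInv, ← contract₃_mul hfg hfh hgh, Units.inv_mul, contract₃_one hfg hfh hgh]

theorem legΦ_pentagon (hfg : SuperCommute 𝒜 𝒜 f g) (hfh : SuperCommute 𝒜 𝒜 f h)
    (hfk : SuperCommute 𝒜 𝒜 f k) (hgh : SuperCommute 𝒜 𝒜 g h) (hgk : SuperCommute 𝒜 𝒜 g k)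
    (hhk : SuperCommute 𝒜 𝒜 h k) :
    H.legΦ (H.comulLeg f g) h k * H.legΦ f g (H.comulLeg h k) =
      H.legΦ f g h * H.legΦ f (H.comulLeg g h) k * H.legΦ g h k := by
  have := congrArg (contract₄ 𝒜 f g h k) H.pentagon
  simp only [contract₄_mul hfg hfh hfk hgh hgk hhk, contract₄_comul₁, contract₄_comul₂,
    contract₄_comul₃, contract₄_emb₁₂₃ hhk.right_one, contract₄_emb₂₃₄ hfg.left_one] at this
  exact this

theorem legΦ_mul_comulLeg (hfg : SuperCommute 𝒜 𝒜 f g) (hfh : SuperCommute 𝒜 𝒜 f h)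
    (hgh : SuperCommute 𝒜 𝒜 g h) (a : A) :
    H.legΦ f g h * H.comulLeg f (H.comulLeg g h) a =
      H.comulLeg (H.comulLeg f g) h a * H.legΦ f g h := by
  have h1 : (H.Φ : Tensor₃ 𝒜) * comulRight 𝒜 H.Δ.toLinearMap (H.Δ a) =
      comulLeft 𝒜 H.Δ.toLinearMap (H.Δ a) * (H.Φ : Tensor₃ 𝒜) := by
    rw [H.quasi_coassoc, mul_assoc, Units.mul_inv_cancel_left]
  have := congrArg (contract₃ 𝒜 f g h) h1
  simp only [contract₃_mul hfg hfh hgh, contract₃_comulLeft, contract₃_comulRight] at this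
  exact this

theorem legΦ_counit_mid (hfh : SuperCommute 𝒜 𝒜 f h) : H.legΦ f (H.counitLeg E) h = 1 := by
  have h2 := congrArg (contract 𝒜 𝒜 f h) H.counit_Φ
  rwa [contract_map, hfh.contract_one, LinearMap.comp_id, ← contract_counitLeg_left] at h2

/-- The pentagon on the legs ε, ε, `f`, `g` says that this value is idempotent; being invertible, it
is 1. -/
theorem legΦ_counit_left (hfg : SuperCommute 𝒜 𝒜 f g) : H.legΦ (H.counitLeg E) f g = 1 := by
  have hf : SuperCommute 𝒜 𝒜 (H.counitLeg E) f := SuperCommute.counitLeg_left hfg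
  have hg : SuperCommute 𝒜 𝒜 (H.counitLeg E) g := SuperCommute.counitLeg_left hfg.symm
  have hε : SuperCommute 𝒜 𝒜 (H.counitLeg E) (H.counitLeg E) := SuperCommute.counitLeg_left hf
  have hfg' : SuperCommute 𝒜 𝒜 (H.counitLeg E) (H.comulLeg f g) :=
    SuperCommute.comulLeg_right hf hg hfg
  have h1 := legΦ_pentagon (H := H) hε hf hg hf hg hfg
  rw [comulLeg_counitLeg_left, comulLeg_counitLeg_left, legΦ_counit_mid hfg', legΦ_counit_mid hf,
    mul_one, one_mul] at h1
  have h2 := congrArg (H.legΦInv (H.counitLeg E) f g * ·) h1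
  simp only [← mul_assoc, legΦInv_mul_legΦ hf hg hfg, one_mul] at h2
  exact h2.symm

theorem legΦ_counit_right (hfg : SuperCommute 𝒜 𝒜 f g) : H.legΦ f g (H.counitLeg E) = 1 := by
  have hf : SuperCommute 𝒜 𝒜 f (H.counitLeg E) := (SuperCommute.counitLeg_left hfg).symm
  have hg : SuperCommute 𝒜 𝒜 g (H.counitLeg E) := (SuperCommute.counitLeg_left hfg.symm).symm
  have hε : SuperCommute 𝒜 𝒜 (H.counitLeg E) (H.counitLeg E) :=
    SuperCommute.counitLeg_left hf.symm
  have hfg' : SuperCommute 𝒜 𝒜 (H.comulLeg f g) (H.counitLeg E) :=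
    SuperCommute.comulLeg_left hfg hf hg
  have h1 := legΦ_pentagon (H := H) hfg hf hf hg hg hε
  rw [comulLeg_counitLeg_left, comulLeg_counitLeg_right, legΦ_counit_mid hfg', legΦ_counit_mid hg,
    mul_one, one_mul] at h1
  have h2 := congrArg (· * H.legΦInv f g (H.counitLeg E)) h1
  simp only [mul_assoc, legΦ_mul_legΦInv hfg hf hg, mul_one] at h2
  exact h2.symm

theorem one_notMem_odd (H : QuasiHopfSuperalgebra 𝒜) : (1 : A) ∉ 𝒜 1 := fun h1 => by
  have := H.ε_odd 1 h1
  rw [map_one] at this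
  exact one_ne_zero this

theorem id_counitLeg_superCommute (H : QuasiHopfSuperalgebra 𝒜) :
    SuperCommute 𝒜 𝒜 (H.counitLeg A) LinearMap.id :=
  counitLeg_superCommute rfl fun _ _ => rfl

theorem contract_counitLeg_mem {n : ZMod 2} {t : Tensor₂ 𝒜} (ht : t ∈ grading₂ 𝒜 n) :
    contract 𝒜 𝒜 (H.counitLeg A) LinearMap.id t ∈ 𝒜 n := by
  induction ht using Submodule.span_induction with
  | mem x hx =>
    obtain ⟨i, j, rfl, a, ha, b, hb, rfl⟩ := hx
    rw [contract_tmul, counitLeg_apply, ← Algebra.smul_def]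
    fin_cases i
    · change _ ∈ 𝒜 (0 + j)
      rw [zero_add]
      exact Submodule.smul_mem _ _ hb
    · rw [H.ε_odd a ha, zero_smul]; exact zero_mem _
  | zero => rw [map_zero]; exact zero_mem _
  | add x y _ _ hx hy => rw [map_add]; exact add_mem hx hy
  | smul r x _ hx => rw [map_smul]; exact Submodule.smul_mem _ _ hx

theorem contract₃_counitLeg_mem {n : ZMod 2} {t : Tensor₃ 𝒜} (ht : t ∈ grading₃ 𝒜 n) :
    contract₃ 𝒜 (H.counitLeg A) (H.counitLeg A) LinearMap.id t ∈ 𝒜 n := by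
  induction ht using Submodule.span_induction with
  | mem x hx =>
    obtain ⟨i, j, rfl, a, ha, b, hb, rfl⟩ := hx
    rw [contract₃, contract_tmul, counitLeg_apply, ← Algebra.smul_def]
    fin_cases i
    · change _ ∈ 𝒜 (0 + j)
      rw [zero_add]
      exact Submodule.smul_mem _ _ (contract_counitLeg_mem hb)
    · rw [H.ε_odd a ha, zero_smul]; exact zero_mem _
  | zero => rw [map_zero]; exact zero_mem _
  | add x y _ _ hx hy => rw [map_add]; exact add_mem hx hy
  | smul r x _ hx => rw [map_smul]; exact Submodule.smul_mem _ _ hx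

/-- Applying ε to the first two factors preserves the degree and sends Φ to 1, which is not odd. -/
theorem Φ_mem_even (H : QuasiHopfSuperalgebra 𝒜) : (H.Φ : Tensor₃ 𝒜) ∈ grading₃ 𝒜 0 := by
  obtain ⟨i, hi⟩ := H.Φ_homogeneous
  fin_cases i
  · exact hi
  · refine absurd ?_ H.one_notMem_odd
    have := contract₃_counitLeg_mem (H := H) hi
    rwa [← legΦ, legΦ_counit_mid H.id_counitLeg_superCommute] at this

end Associator

section RMatrix

variable {R : (Tensor₂ 𝒜)ˣ}

/-- The image of `R` under `a ⊗ b ↦ f(a) g(b)`. -/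
def legR (R : (Tensor₂ 𝒜)ˣ) (f g : A →ₗ[K] E) : E := contract 𝒜 𝒜 f g (R : Tensor₂ 𝒜)

theorem legR_mul_legR_inv (hfg : SuperCommute 𝒜 𝒜 f g) : legR R f g * legR R⁻¹ f g = 1 := by
  rw [legR, legR, ← hfg.contract_mul, Units.mul_inv, hfg.contract_one]

theorem legR_inv_mul_legR (hfg : SuperCommute 𝒜 𝒜 f g) : legR R⁻¹ f g * legR R f g = 1 := by
  rw [legR, legR, ← hfg.contract_mul, Units.inv_mul, hfg.contract_one]

namespace IsUniversalRMatrix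

theorem legR_mul_comulLeg (hR : H.IsUniversalRMatrix R) (hfg : SuperCommute 𝒜 𝒜 f g) (a : A) :
    legR R f g * H.comulLeg f g a = H.comulLeg g f a * legR R f g := by
  have := congrArg (contract 𝒜 𝒜 f g) (hR.intertwine a)
  simp only [hfg.contract_mul, contract_twist hfg] at this
  exact this.symm

theorem legR_inv_mul_comulLeg (hR : H.IsUniversalRMatrix R) (hfg : SuperCommute 𝒜 𝒜 f g) (a : A) :
    legR R⁻¹ f g * H.comulLeg g f a = H.comulLeg f g a * legR R⁻¹ f g := by
  calc legR R⁻¹ f g * H.comulLeg g f a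
      = legR R⁻¹ f g * (H.comulLeg g f a * legR R f g) * legR R⁻¹ f g := by
        rw [mul_assoc, mul_assoc, legR_mul_legR_inv hfg, mul_one]
    _ = H.comulLeg f g a * legR R⁻¹ f g := by
        rw [← hR.legR_mul_comulLeg hfg, ← mul_assoc, legR_inv_mul_legR hfg, one_mul]

theorem legR_comulLeg_left (hR : H.IsUniversalRMatrix R) (hfg : SuperCommute 𝒜 𝒜 f g)
    (hfh : SuperCommute 𝒜 𝒜 f h) (hgh : SuperCommute 𝒜 𝒜 g h) :
    legR R (H.comulLeg f g) h =
      H.legΦInv h f g * legR R f h * H.legΦ f h g * legR R g h * H.legΦInv f g h := by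
  have := congrArg (contract₃ 𝒜 f g h) hR.hexagon_left
  simp only [contract₃_mul hfg hfh hgh, contract₃_comulLeft, contract₃_twist₂₃ hgh,
    contract₃_twist₁₂ hfh, contract₃_emb₁₃ hgh, contract₃_emb₂₃ hfg.left_one] at this
  exact this

theorem legR_comulLeg_right (hR : H.IsUniversalRMatrix R) (hfg : SuperCommute 𝒜 𝒜 f g)
    (hfh : SuperCommute 𝒜 𝒜 f h) (hgh : SuperCommute 𝒜 𝒜 g h) :
    legR R f (H.comulLeg g h) =
      H.legΦ g h f * legR R f h * H.legΦInv g f h * legR R f g * H.legΦ f g h := by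
  have := congrArg (contract₃ 𝒜 f g h) hR.hexagon_right
  simp only [contract₃_mul hfg hfh hgh, contract₃_comulRight, contract₃_twist₁₂ hfg,
    contract₃_twist₂₃ hfh, contract₃_emb₁₃ hgh, contract₃_emb₁₂ hgh.right_one] at this
  exact this

end IsUniversalRMatrix

theorem legΦInv_eq_one (hfg : SuperCommute 𝒜 𝒜 f g) (hfh : SuperCommute 𝒜 𝒜 f h)
    (hgh : SuperCommute 𝒜 𝒜 g h) (h1 : H.legΦ f g h = 1) : H.legΦInv f g h = 1 := by
  simpa [h1] using legΦ_mul_legΦInv (H := H) hfg hfh hgh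

namespace IsUniversalRMatrix

/-- The left hexagon on the legs ε, ε, `f` makes this invertible value idempotent. -/
theorem legR_counit_left (hR : H.IsUniversalRMatrix R) (h1 : f 1 = 1)
    (hmul : ∀ a b, f (a * b) = f a * f b) : legR R (H.counitLeg E) f = 1 := by
  have hf : SuperCommute 𝒜 𝒜 (H.counitLeg E) f := counitLeg_superCommute h1 hmul
  have hε : SuperCommute 𝒜 𝒜 (H.counitLeg E) (H.counitLeg E) := SuperCommute.counitLeg_left hf
  have h2 := hR.legR_comulLeg_left hε hf hf
  rw [comulLeg_counitLeg_left, legΦ_counit_left hf.symm,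
    legΦInv_eq_one hf.symm hf.symm hε (legΦ_counit_mid hf.symm),
    legΦInv_eq_one hε hf hf (legΦ_counit_mid hf), mul_one, mul_one, one_mul] at h2
  have h3 := congrArg (· * legR R⁻¹ (H.counitLeg E) f) h2
  simp only [mul_assoc, legR_mul_legR_inv hf, mul_one] at h3
  exact h3.symm

theorem legR_counit_right (hR : H.IsUniversalRMatrix R) (h1 : f 1 = 1)
    (hmul : ∀ a b, f (a * b) = f a * f b) : legR R f (H.counitLeg E) = 1 := by
  have hf : SuperCommute 𝒜 𝒜 (H.counitLeg E) f := counitLeg_superCommute h1 hmul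
  have hε : SuperCommute 𝒜 𝒜 (H.counitLeg E) (H.counitLeg E) := SuperCommute.counitLeg_left hf
  have h2 := hR.legR_comulLeg_right hf.symm hf.symm hε
  rw [comulLeg_counitLeg_left, legΦ_counit_mid hf, legΦ_counit_mid hf.symm,
    legΦInv_eq_one hf hε hf.symm (legΦ_counit_right hf), mul_one, mul_one, one_mul] at h2
  have h3 := congrArg (· * legR R⁻¹ f (H.counitLeg E)) h2
  simp only [mul_assoc, legR_mul_legR_inv hf.symm, mul_one] at h3
  exact h3.symm

theorem mem_even (hR : H.IsUniversalRMatrix R) : (R : Tensor₂ 𝒜) ∈ grading₂ 𝒜 0 := by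
  obtain ⟨i, hi⟩ := hR.homogeneous
  fin_cases i
  · exact hi
  · refine absurd ?_ H.one_notMem_odd
    have := contract_counitLeg_mem (H := H) hi
    rwa [← legR, hR.legR_counit_left rfl fun _ _ => rfl] at this

theorem commute_legR (hR : H.IsUniversalRMatrix R) (hfg : SuperCommute 𝒜 𝒜 f g)
    (hfh : SuperCommute 𝒜 𝒜 f h) (hgh : SuperCommute 𝒜 𝒜 g h) (a : A) :
    legR R f g * h a = h a * legR R f g :=
  ((hfh.symm.contract_right hgh.symm hfg).commute_of_mem_zero hR.mem_even a).symm

theorem commute_legR_inv (hR : H.IsUniversalRMatrix R) (hfg : SuperCommute 𝒜 𝒜 f g)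
    (hfh : SuperCommute 𝒜 𝒜 f h) (hgh : SuperCommute 𝒜 𝒜 g h) (a : A) :
    legR R⁻¹ f g * h a = h a * legR R⁻¹ f g := by
  calc legR R⁻¹ f g * h a = legR R⁻¹ f g * (h a * legR R f g) * legR R⁻¹ f g := by
        rw [mul_assoc, mul_assoc, legR_mul_legR_inv hfg, mul_one]
    _ = h a * legR R⁻¹ f g := by
        rw [← hR.commute_legR hfg hfh hgh, ← mul_assoc, legR_inv_mul_legR hfg, one_mul]

end IsUniversalRMatrix

end RMatrix

end QuasiHopfSuperalgebra

namespace QuasiHopfSuperalgebra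

open SuperTensor GradedTensorProduct

variable {K A E N : Type*} [Field K] [Ring A] [Algebra K A] [Ring E] [Algebra K E]
variable [AddCommGroup N] [Module K N]
variable {𝒜 : ZMod 2 → Submodule K A} [GradedAlgebra 𝒜]
variable {H : QuasiHopfSuperalgebra 𝒜} {f f' g g' h h' : A →ₗ[K] E} {G : E →ₗ[K] N}

theorem mul_legΦ_eq {W : E} (hf : ∀ a, W * f a = f' a * W) (hg : ∀ a, W * g a = g' a * W)
    (hh : ∀ a, W * h a = h' a * W) : W * H.legΦ f g h = H.legΦ f' g' h' * W :=
  mul_contract_eq hf (mul_contract_eq hg hh) _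

theorem mul_comulLeg_eq {W : E} (hf : ∀ a, W * f a = f' a * W) (hg : ∀ a, W * g a = g' a * W)
    (a : A) : W * H.comulLeg f g a = H.comulLeg f' g' a * W :=
  mul_contract_eq hf hg _

/-! ### Deleting Φ and R under a functional that absorbs one of their legs. -/

section Absorb

variable {φ : A →ₗ[K] E}

/-- Under `G` the leg `φ` becomes the counit, and Φ with a counit in any slot is 1. In the
applications `φ` is a coproduct of two legs. -/
theorem apply_mul_legΦ_absorb_left (hφ : ∀ x a, G (x * φ a) = G (x * H.counitLeg E a))
    (hφf : SuperCommute 𝒜 𝒜 φ f) (hφg : SuperCommute 𝒜 𝒜 φ g) (hfg : SuperCommute 𝒜 𝒜 f g)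
    (x : E) : G (x * H.legΦ φ f g) = G x := by
  have h1 := apply_mul_contract_congr_left (hφf.contract_right hφg hfg)
    ((SuperCommute.counitLeg_left hfg).contract_right (SuperCommute.counitLeg_left hfg.symm) hfg)
    hφ x (H.Φ : Tensor₃ 𝒜)
  have h2 : contract 𝒜 (grading₂ 𝒜) (H.counitLeg E) (contract 𝒜 𝒜 f g) (H.Φ : Tensor₃ 𝒜) = 1 :=
    legΦ_counit_left hfg
  rw [h2, mul_one] at h1
  exact h1

theorem apply_mul_legΦ_absorb_mid (hφ : ∀ x a, G (x * φ a) = G (x * H.counitLeg E a))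
    (hφg : SuperCommute 𝒜 𝒜 φ g) (hfg : SuperCommute 𝒜 𝒜 f g)
    (x : E) : G (x * H.legΦ f φ g) = G x := by
  have h1 := apply_mul_contract_congr_right (f := f) (apply_mul_contract_congr_left hφg
    (SuperCommute.counitLeg_left hfg.symm) hφ) x (H.Φ : Tensor₃ 𝒜)
  have h2 : contract 𝒜 (grading₂ 𝒜) f (contract 𝒜 𝒜 (H.counitLeg E) g) (H.Φ : Tensor₃ 𝒜) = 1 :=
    legΦ_counit_mid hfg
  rw [h2, mul_one] at h1
  exact h1

theorem apply_mul_legΦ_absorb_right (hφ : ∀ x a, G (x * φ a) = G (x * H.counitLeg E a))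
    (hfg : SuperCommute 𝒜 𝒜 f g) (x : E) : G (x * H.legΦ f g φ) = G x := by
  have h1 := apply_mul_contract_congr_right (f := f) (apply_mul_contract_congr_right (f := g) hφ)
    x (H.Φ : Tensor₃ 𝒜)
  have h2 : contract 𝒜 (grading₂ 𝒜) f (contract 𝒜 𝒜 g (H.counitLeg E)) (H.Φ : Tensor₃ 𝒜) = 1 :=
    legΦ_counit_right hfg
  rw [h2, mul_one] at h1
  exact h1

/-- Absorption at the left end tolerates a prefactor `c` only because `c` commutes with `φ`. -/
theorem apply_legΦ_mul_absorb {c : E} (hφ : ∀ a x, G (φ a * x) = G (H.counitLeg E a * x))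
    (hc : ∀ a, c * φ a = φ a * c) (hfg : SuperCommute 𝒜 𝒜 f g) (x : E) :
    G (c * H.legΦ φ f g * x) = G (c * x) := by
  have h1 := apply_contract_mul_congr_left (g := contract 𝒜 𝒜 f g) (c := c) (f := φ)
    (f' := H.counitLeg E) (G := G) (fun a x => by
      rw [hc, mul_assoc, hφ, counitLeg_apply, ← mul_assoc, Algebra.commutes]) (H.Φ : Tensor₃ 𝒜) x
  have h2 : contract 𝒜 (grading₂ 𝒜) (H.counitLeg E) (contract 𝒜 𝒜 f g) (H.Φ : Tensor₃ 𝒜) = 1 :=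
    legΦ_counit_left hfg
  rw [h2, mul_one] at h1
  exact h1

theorem apply_legΦInv_mul_absorb {c : E} (hφ : ∀ a x, G (φ a * x) = G (H.counitLeg E a * x))
    (hc : ∀ a, c * φ a = φ a * c) (hφf : SuperCommute 𝒜 𝒜 φ f) (hφg : SuperCommute 𝒜 𝒜 φ g)
    (hfg : SuperCommute 𝒜 𝒜 f g) (x : E) : G (c * H.legΦInv φ f g * x) = G (c * x) := by
  rw [mul_assoc, ← apply_legΦ_mul_absorb hφ hc hfg, mul_assoc, ← mul_assoc (H.legΦ φ f g),
    legΦ_mul_legΦInv hφf hφg hfg, one_mul]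

variable {R : (Tensor₂ 𝒜)ˣ}

theorem IsUniversalRMatrix.apply_mul_legR_absorb_left (hR : H.IsUniversalRMatrix R)
    (hφ : ∀ x a, G (x * φ a) = G (x * H.counitLeg E a)) (hφf : SuperCommute 𝒜 𝒜 φ f) (x : E) :
    G (x * legR R φ f) = G x := by
  have h1 := apply_mul_contract_congr_left hφf (SuperCommute.counitLeg_left hφf.symm)
    hφ x (R : Tensor₂ 𝒜)
  have h2 : contract 𝒜 𝒜 (H.counitLeg E) f (R : Tensor₂ 𝒜) = 1 :=
    hR.legR_counit_left hφf.right_one hφf.right_mul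
  rw [h2, mul_one] at h1
  exact h1

theorem IsUniversalRMatrix.apply_mul_legR_absorb_right (hR : H.IsUniversalRMatrix R)
    (hφ : ∀ x a, G (x * φ a) = G (x * H.counitLeg E a)) (h1 : f 1 = 1)
    (hmul : ∀ a b, f (a * b) = f a * f b) (x : E) : G (x * legR R f φ) = G x := by
  have h3 := apply_mul_contract_congr_right (f := f) hφ x (R : Tensor₂ 𝒜)
  have h2 : contract 𝒜 𝒜 f (H.counitLeg E) (R : Tensor₂ 𝒜) = 1 := hR.legR_counit_right h1 hmul
  rw [h2, mul_one] at h3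
  exact h3

end Absorb

/-! ### Two identities for Φ and R on four legs. -/

section FourLegs

variable {R : (Tensor₂ 𝒜)ˣ} {p q r s : A →ₗ[K] E}

theorem commute_legΦ (hpq : SuperCommute 𝒜 𝒜 p q) (hpr : SuperCommute 𝒜 𝒜 p r)
    (hps : SuperCommute 𝒜 𝒜 p s) (hqr : SuperCommute 𝒜 𝒜 q r) (hqs : SuperCommute 𝒜 𝒜 q s)
    (hrs : SuperCommute 𝒜 𝒜 r s) (a : A) : H.legΦ p q r * s a = s a * H.legΦ p q r :=
  ((hps.symm.contract_right (hqs.symm.contract_right hrs.symm hqr)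
    (hpq.contract_right hpr hqr)).commute_of_mem_zero H.Φ_mem_even a).symm

/-- If `W` flips `Δ` on the legs `p`, `q`, then the leg `p` at the right end of `W Φ` can be moved
to the leg `r` at the left end, under a functional that absorbs `Δ`. -/
theorem apply_mul_legΦ_mul_leg {W : E} (hpq : SuperCommute 𝒜 𝒜 p q) (hpr : SuperCommute 𝒜 𝒜 p r)
    (hqr : SuperCommute 𝒜 𝒜 q r) (hW : ∀ a, W * H.comulLeg p q a = H.comulLeg q p a * W)
    (hWr : ∀ a, W * r a = r a * W)
    (hGqr : ∀ x a, G (x * H.comulLeg q r a) = G (x * H.counitLeg E a))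
    (hGqp : ∀ a x, G (H.comulLeg q p a * x) = G (H.counitLeg E a * x)) (a : A) :
    G (W * H.legΦ p q r * p a) = G (r a * (W * H.legΦ p q r)) := by
  -- Write p(a) as ∑ p(a₍₁₎) ε(a₍₂₎) and let `G` expand ε(a₍₂₎) on the legs q, r.
  -- Quasi-coassociativity carries the result to the left of Φ, `W` flips p and q, and the pair (q,
  -- p) is absorbed there.
  calc G (W * H.legΦ p q r * p a)
      = G (W * H.legΦ p q r * H.comulLeg p (H.comulLeg q r) a) := by
        refine Eq.trans ?_ (apply_mul_contract_congr_right hGqr _ (H.Δ a)).symm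
        exact congrArg (fun l : A →ₗ[K] E => G (W * H.legΦ p q r * l a))
          (comulLeg_counitLeg_right p).symm
    _ = G (H.comulLeg (H.comulLeg q p) r a * (W * H.legΦ p q r)) := by
        rw [mul_assoc, legΦ_mul_comulLeg hpq hpr hqr, ← mul_assoc, mul_comulLeg_eq hW hWr,
          mul_assoc]
    _ = G (r a * (W * H.legΦ p q r)) := by
        have h1 := apply_contract_mul_congr_left (g := r) (c := (1 : E))
          (f := H.comulLeg q p) (f' := H.counitLeg E) (G := G)
          (fun a x => by rw [one_mul, one_mul, hGqp]) (H.Δ a) (W * H.legΦ p q r)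
        rw [one_mul, one_mul] at h1
        refine h1.trans ?_
        exact congrArg (fun l : A →ₗ[K] E => G (l a * (W * H.legΦ p q r)))
          (comulLeg_counitLeg_left r)

/-- For the legs P, Q, Q', P' this becomes uβ = S(n). Extra factors that `G` absorbs are inserted on
the right; pentagons and hexagons then rearrange the product until every superfluous factor has a
coproduct slot absorbed at one end. -/
theorem IsUniversalRMatrix.apply_legR_mul_legΦ (hR : H.IsUniversalRMatrix R)
    (hpq : SuperCommute 𝒜 𝒜 p q) (hpr : SuperCommute 𝒜 𝒜 p r)
    (hps : SuperCommute 𝒜 𝒜 p s) (hqr : SuperCommute 𝒜 𝒜 q r) (hqs : SuperCommute 𝒜 𝒜 q s)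
    (hrs : SuperCommute 𝒜 𝒜 r s)
    (hGps : ∀ x a, G (x * H.comulLeg p s a) = G (x * H.counitLeg E a))
    (hGqr : ∀ x a, G (x * H.comulLeg q r a) = G (x * H.counitLeg E a))
    (hGqp : ∀ a x, G (H.comulLeg q p a * x) = G (H.counitLeg E a * x)) :
    G (legR R p q * H.legΦ p q r) = G (legR R s r * H.legΦ q p s) := by
  have hqp := hpq.symm
  have hsp := hps.symm
  have hsq := hqs.symm
  have hsr := hrs.symm
  have hqr_s : SuperCommute 𝒜 𝒜 (H.comulLeg q r) s := SuperCommute.comulLeg_left hqr hqs hrs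
  have hps_q : SuperCommute 𝒜 𝒜 (H.comulLeg p s) q := SuperCommute.comulLeg_left hps hpq hqs.symm
  have hps_r : SuperCommute 𝒜 𝒜 (H.comulLeg p s) r := SuperCommute.comulLeg_left hps hpr hrs.symm
  have hqp_r : SuperCommute 𝒜 𝒜 (H.comulLeg q p) r := SuperCommute.comulLeg_left hqp hqr hpr
  have hqp_s : SuperCommute 𝒜 𝒜 (H.comulLeg q p) s := SuperCommute.comulLeg_left hqp hqs hps
  have hpq_r : SuperCommute 𝒜 𝒜 (H.comulLeg p q) r := SuperCommute.comulLeg_left hpq hpr hqr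
  have hpq_s : SuperCommute 𝒜 𝒜 (H.comulLeg p q) s := SuperCommute.comulLeg_left hpq hps hqs
  -- the crossing of the legs `p`, `q` carries `Δ` past itself
  have hW := hR.legR_mul_comulLeg (E := E) hpq
  have hWr := hR.commute_legR hpq hpr hqr
  have hWs := hR.commute_legR hpq hps hqs
  calc G (legR R p q * H.legΦ p q r)
      = G (legR R p q * H.legΦ p q r * H.legΦ p (H.comulLeg q r) s *
          legR R s (H.comulLeg q r)) := by
        rw [hR.apply_mul_legR_absorb_right hGqr hrs.right_one hrs.right_mul,
          apply_mul_legΦ_absorb_mid hGqr hqr_s hps]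
    -- The right hexagon expands R on (s, qr), the pentagon for p, q, r, s applies, and R on (p, q)
    -- flips pq to qp on passing Φ.
    _ = G (1 * H.legΦ (H.comulLeg q p) r s * (legR R p q * H.legΦ p q (H.comulLeg r s) * legR R s r *
          H.legΦInv q s r * legR R s q * H.legΦ s q r)) := by
        congr 1
        calc _ = legR R p q * (H.legΦ p q r * H.legΦ p (H.comulLeg q r) s * H.legΦ q r s) *
              (legR R s r * H.legΦInv q s r * legR R s q * H.legΦ s q r) := by
              rw [hR.legR_comulLeg_right hsq hsr hqr]; simp only [mul_assoc]
          _ = (legR R p q * H.legΦ (H.comulLeg p q) r s) * (H.legΦ p q (H.comulLeg r s) *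
              (legR R s r * H.legΦInv q s r * legR R s q * H.legΦ s q r)) := by
              rw [← legΦ_pentagon hpq hpr hps hqr hqs hrs]; simp only [mul_assoc]
          _ = _ := by rw [mul_legΦ_eq hW hWr hWs]; simp only [mul_assoc, one_mul]
    _ = G (legR R p q * (H.legΦ p q (H.comulLeg r s) * legR R s r) *
          H.legΦInv q s r * legR R s q * H.legΦ s q r) := by
        rw [apply_legΦ_mul_absorb hGqp (fun a => by rw [one_mul, mul_one]) hrs]
        simp only [mul_assoc, one_mul]
    -- R on (s, r) moves to the front and exchanges r and s, so the pentagon for p, q, s, r applies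
    -- next.
    _ = G (legR R s r * H.legΦInv (H.comulLeg q p) s r * (legR R p q * H.legΦ p q s *
          H.legΦ p (H.comulLeg q s) r * legR R s q * H.legΦ s q r)) := by
        congr 1
        have h1 : H.legΦ p q (H.comulLeg r s) * legR R s r =
            legR R s r * H.legΦ p q (H.comulLeg s r) :=
          (mul_legΦ_eq (hR.commute_legR hsr hsp hpr.symm) (hR.commute_legR hsr hsq hqr.symm)
            (hR.legR_mul_comulLeg hsr)).symm
        have h2 : H.legΦ p q (H.comulLeg s r) * H.legΦInv q s r =
            H.legΦInv (H.comulLeg p q) s r * H.legΦ p q s * H.legΦ p (H.comulLeg q s) r := by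
          calc _ = H.legΦInv (H.comulLeg p q) s r * (H.legΦ (H.comulLeg p q) s r *
                H.legΦ p q (H.comulLeg s r)) * H.legΦInv q s r := by
                rw [← mul_assoc (H.legΦInv _ _ _), legΦInv_mul_legΦ hpq_s hpq_r hsr, one_mul]
            _ = _ := by
                rw [legΦ_pentagon hpq hps hpr hqs hqr hsr]
                simp only [mul_assoc, legΦ_mul_legΦInv hqs hqr hsr, mul_one]
        have h3 : legR R p q * H.legΦInv (H.comulLeg p q) s r =
            H.legΦInv (H.comulLeg q p) s r * legR R p q :=
          mul_contract_eq hW (mul_contract_eq hWs hWr) _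
        have h4 : legR R p q * legR R s r = legR R s r * legR R p q :=
          mul_contract_eq hWs hWr _
        calc _ = (legR R p q * legR R s r) * (H.legΦ p q (H.comulLeg s r) * H.legΦInv q s r) *
              (legR R s q * H.legΦ s q r) := by rw [h1]; simp only [mul_assoc]
          _ = legR R s r * (legR R p q * H.legΦInv (H.comulLeg p q) s r) * H.legΦ p q s *
              H.legΦ p (H.comulLeg q s) r * (legR R s q * H.legΦ s q r) := by
              rw [h2, h4]; simp only [mul_assoc]
          _ = _ := by rw [h3]; simp only [mul_assoc]
    _ = G (legR R s r * legR R p q * H.legΦ p q s *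
          (H.legΦ p (H.comulLeg q s) r * legR R s q) * H.legΦ s q r) := by
        rw [apply_legΦInv_mul_absorb hGqp (hR.commute_legR hsr
          (SuperCommute.comulLeg_right hsq hsp hqp)
          (SuperCommute.comulLeg_right hqr.symm hpr.symm hqp)) hqp_s hqp_r hsr]
        simp only [mul_assoc]
    -- Sliding R on (s, q) leftwards opens the pentagon for p, s, q, r; its two factors with slots
    -- ps and qr land at the right end, ready for absorption.
    _ = G (legR R s r * legR R p q * H.legΦ p q s * legR R s q * H.legΦInv p s q *
          H.legΦ (H.comulLeg p s) q r * H.legΦ p s (H.comulLeg q r)) := by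
        congr 1
        have h1 : H.legΦ p (H.comulLeg q s) r * legR R s q =
            legR R s q * H.legΦ p (H.comulLeg s q) r :=
          (mul_legΦ_eq (hR.commute_legR hsq hsp hqp) (hR.legR_mul_comulLeg hsq)
            (hR.commute_legR hsq hsr hqr)).symm
        have h2 : H.legΦ p (H.comulLeg s q) r * H.legΦ s q r =
            H.legΦInv p s q * H.legΦ (H.comulLeg p s) q r * H.legΦ p s (H.comulLeg q r) := by
          rw [mul_assoc, legΦ_pentagon hps hpq hpr hsq hsr hqr, ← mul_assoc, ← mul_assoc,
            legΦInv_mul_legΦ hps hpq hsq, one_mul]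
        calc _ = legR R s r * legR R p q * H.legΦ p q s * legR R s q *
              (H.legΦ p (H.comulLeg s q) r * H.legΦ s q r) := by rw [h1]; simp only [mul_assoc]
          _ = _ := by rw [h2]; simp only [mul_assoc]
    _ = G (legR R s r * legR R p q * H.legΦ p q s * legR R s q * H.legΦInv p s q) := by
        rw [apply_mul_legΦ_absorb_right hGqr hps, apply_mul_legΦ_absorb_left hGps hps_q hps_r hqr]
    -- The left hexagon read backwards, after inserting Φ Φ⁻¹ on (q, p, s).
    _ = G (legR R s r * H.legΦ q p s * legR R (H.comulLeg p s) q) := by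
        congr 1
        rw [hR.legR_comulLeg_left hps hpq hsq]
        calc _ = legR R s r * (H.legΦ q p s * H.legΦInv q p s) * (legR R p q * H.legΦ p q s *
              legR R s q * H.legΦInv p s q) := by
              rw [legΦ_mul_legΦInv hqp hqs hps]; simp only [mul_assoc, one_mul]
          _ = _ := by simp only [mul_assoc]
    _ = G (legR R s r * H.legΦ q p s) := hR.apply_mul_legR_absorb_left hGps hps_q _

/-- For the legs P, Q, Q', P' this becomes wn = S(β). The inverse of R on (q, p) flips coproducts on
p, q just as R on (p, q) does. -/
theorem IsUniversalRMatrix.apply_legR_inv_mul_legΦ_mul_legR (hR : H.IsUniversalRMatrix R)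
    (hpq : SuperCommute 𝒜 𝒜 p q) (hpr : SuperCommute 𝒜 𝒜 p r)
    (hps : SuperCommute 𝒜 𝒜 p s) (hqr : SuperCommute 𝒜 𝒜 q r) (hqs : SuperCommute 𝒜 𝒜 q s)
    (hrs : SuperCommute 𝒜 𝒜 r s)
    (hGps : ∀ x a, G (x * H.comulLeg p s a) = G (x * H.counitLeg E a))
    (hGqr : ∀ x a, G (x * H.comulLeg q r a) = G (x * H.counitLeg E a))
    (hGqp : ∀ a x, G (H.comulLeg q p a * x) = G (H.counitLeg E a * x)) :
    G (legR R⁻¹ q p * H.legΦ p q r * legR R p s) = G (H.legΦ q p s) := by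
  have hqp := hpq.symm
  have hrp := hpr.symm
  have hsr := hrs.symm
  have hrq := hqr.symm
  have hqr_p : SuperCommute 𝒜 𝒜 (H.comulLeg q r) p := SuperCommute.comulLeg_left hqr hqp hrp
  have hqr_s : SuperCommute 𝒜 𝒜 (H.comulLeg q r) s := SuperCommute.comulLeg_left hqr hqs hrs
  have hp_qr := hqr_p.symm
  have hps_r : SuperCommute 𝒜 𝒜 (H.comulLeg p s) r := SuperCommute.comulLeg_left hps hpr hrs.symm
  have hqp_r : SuperCommute 𝒜 𝒜 (H.comulLeg q p) r := SuperCommute.comulLeg_left hqp hqr hpr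
  have hqp_s : SuperCommute 𝒜 𝒜 (H.comulLeg q p) s := SuperCommute.comulLeg_left hqp hqs hps
  have hW := hR.legR_inv_mul_comulLeg (E := E) hqp
  have hWr := hR.commute_legR_inv hqp hqr hpr
  have hWs := hR.commute_legR_inv hqp hqs hps
  have hV : ∀ a, legR R r s * H.comulLeg q p a = H.comulLeg q p a * legR R r s :=
    hR.commute_legR hrs hqp_r.symm hqp_s.symm
  calc G (legR R⁻¹ q p * H.legΦ p q r * legR R p s)
      = G (legR R r s * (legR R⁻¹ q p * H.legΦ p q r)) := by
        have hWΦ : ∀ a, legR R⁻¹ q p * H.legΦ p q r * s a =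
            s a * (legR R⁻¹ q p * H.legΦ p q r) := fun a => by
          rw [mul_assoc, commute_legΦ hpq hpr hps hqr hqs hrs, ← mul_assoc, hWs, mul_assoc]
        have h1 : ∀ t : Tensor₂ 𝒜, G (legR R⁻¹ q p * H.legΦ p q r * contract 𝒜 𝒜 p s t) =
            G (contract 𝒜 𝒜 r s t * (legR R⁻¹ q p * H.legΦ p q r)) := fun t => by
          induction t using tmul_induction with
          | hadd x y hx hy => simp only [map_add, mul_add, add_mul, hx, hy]
          | h a b =>
            -- The factor s(b) is hidden in the functional, which still absorbs (q, r) on the right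
            -- because these legs supercommute with s.
            have h2 := apply_mul_legΦ_mul_leg (G := G ∘ₗ LinearMap.mulRight K (s b)) hpq hpr hqr
              hW hWr (fun x a => by
                simpa only [contract_tmul, LinearMap.comp_apply, LinearMap.mulRight_apply,
                  mul_assoc] using apply_mul_contract_congr_left hqr_s
                    (SuperCommute.counitLeg_left hsr) hGqr x (a ᵍ⊗ₜ[K] b))
              (fun a x => by
                simpa only [LinearMap.comp_apply, LinearMap.mulRight_apply, mul_assoc] using
                  hGqp a (x * s b)) a
            simp only [LinearMap.comp_apply, LinearMap.mulRight_apply] at h2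
            rw [contract_tmul, contract_tmul, ← mul_assoc, h2, mul_assoc (r a), hWΦ, mul_assoc]
        exact h1 _
    -- This factor is inserted because its hexagon expansion begins with the inverse of Φ on (p, q,
    -- r) followed by R on (q, p), cancelling the factors before it.
    _ = G (legR R r s * (legR R⁻¹ q p * H.legΦ p q r) * legR R (H.comulLeg q r) p) :=
        (hR.apply_mul_legR_absorb_left hGqr hqr_p _).symm
    _ = G (legR R r s * (H.legΦ q p r * legR R r p * H.legΦInv q r p)) := by
        congr 1
        rw [hR.legR_comulLeg_left hqr hqp hrp]
        calc _ = legR R r s * (legR R⁻¹ q p * ((H.legΦ p q r * H.legΦInv p q r) * legR R q p)) *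
              (H.legΦ q p r * legR R r p * H.legΦInv q r p) := by simp only [mul_assoc]
          _ = _ := by
              rw [legΦ_mul_legΦInv hpq hpr hqr, one_mul, legR_inv_mul_legR hqp, mul_one]
    _ = G (legR R r s * (H.legΦ q p r * legR R r p * H.legΦInv q r p) *
          H.legΦ (H.comulLeg q r) p s * H.legΦ q r (H.comulLeg p s)) := by
        rw [apply_mul_legΦ_absorb_right hGps hqr, apply_mul_legΦ_absorb_left hGqr hqr_p hqr_s hps]
    -- Two pentagons, for q, r, p, s and for q, p, r, s, linked by R on (r, p), which exchanges p
    -- and r.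
    _ = G (legR R r s * H.legΦ (H.comulLeg q p) r s * (H.legΦ q p (H.comulLeg r s) *
          H.legΦInv p r s * legR R r p * H.legΦ r p s)) := by
        congr 1
        have h1 : legR R r p * H.legΦ q (H.comulLeg r p) s =
            H.legΦ q (H.comulLeg p r) s * legR R r p :=
          mul_legΦ_eq (hR.commute_legR hrp hrq hpq) (hR.legR_mul_comulLeg hrp)
            (hR.commute_legR hrp hrs hps)
        have h2 : H.legΦ q p r * H.legΦ q (H.comulLeg p r) s =
            H.legΦ (H.comulLeg q p) r s * H.legΦ q p (H.comulLeg r s) * H.legΦInv p r s := by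
          rw [legΦ_pentagon hqp hqr hqs hpr hps hrs, mul_assoc, legΦ_mul_legΦInv hpr hps hrs,
            mul_one]
        calc _ = legR R r s * H.legΦ q p r * legR R r p * H.legΦInv q r p *
              (H.legΦ (H.comulLeg q r) p s * H.legΦ q r (H.comulLeg p s)) := by
              simp only [mul_assoc]
          _ = legR R r s * H.legΦ q p r * legR R r p * (H.legΦInv q r p * H.legΦ q r p) *
              H.legΦ q (H.comulLeg r p) s * H.legΦ r p s := by
              rw [legΦ_pentagon hqr hqp hqs hrp hrs hps]; simp only [mul_assoc]
          _ = legR R r s * H.legΦ q p r * (legR R r p * H.legΦ q (H.comulLeg r p) s) *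
              H.legΦ r p s := by
              rw [legΦInv_mul_legΦ hqr hqp hrp, mul_one]; simp only [mul_assoc]
          _ = legR R r s * (H.legΦ q p r * H.legΦ q (H.comulLeg p r) s) * legR R r p *
              H.legΦ r p s := by rw [h1]; simp only [mul_assoc]
          _ = _ := by rw [h2]; simp only [mul_assoc]
    _ = G ((legR R r s * H.legΦ q p (H.comulLeg r s)) * H.legΦInv p r s * legR R r p *
          H.legΦ r p s) := by
        rw [apply_legΦ_mul_absorb hGqp hV hrs]; simp only [mul_assoc]
    _ = G (H.legΦ q p (H.comulLeg s r) * H.legΦInv p s r * legR R r (H.comulLeg p s)) := by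
        congr 1
        rw [mul_legΦ_eq (hR.commute_legR hrs hrq hqs.symm) (hR.commute_legR hrs hrp hps.symm)
          (hR.legR_mul_comulLeg hrs), hR.legR_comulLeg_right hrp hrs hps]
        calc _ = H.legΦ q p (H.comulLeg s r) * (H.legΦInv p s r * H.legΦ p s r) * legR R r s *
              H.legΦInv p r s * legR R r p * H.legΦ r p s := by
              rw [legΦInv_mul_legΦ hps hpr hsr, mul_one]
          _ = _ := by simp only [mul_assoc]
    -- A Φ absorbed on the left is inserted to complete one side of the pentagon for q, p, s, r.
    _ = G (1 * H.legΦ (H.comulLeg q p) s r * (H.legΦ q p (H.comulLeg s r) * H.legΦInv p s r)) := by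
        rw [hR.apply_mul_legR_absorb_right hGps hpr.right_one hpr.right_mul,
          apply_legΦ_mul_absorb hGqp (fun a => by rw [one_mul, mul_one]) hsr, one_mul]
    _ = G (H.legΦ q p s * H.legΦ q (H.comulLeg p s) r) := by
        congr 1
        rw [one_mul, ← mul_assoc, legΦ_pentagon hqp hqs hqr hps hpr hsr, mul_assoc,
          legΦ_mul_legΦInv hps hpr hsr, mul_one]
    _ = G (H.legΦ q p s) := apply_mul_legΦ_absorb_mid hGps hps_r hqr _

end FourLegs

end QuasiHopfSuperalgebra

namespace SuperTensor

/-! ### Operators with Koszul signs on a tensor square. -/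

section Koszul

variable {K A M : Type*} [Field K] [Ring A] [Algebra K A] [AddCommGroup M] [Module K M]
variable {𝒜 : ZMod 2 → Submodule K A} [GradedAlgebra 𝒜]

theorem parity_of_mem {i : ZMod 2} {a : A} (ha : a ∈ 𝒜 i) : parity 𝒜 a = sgn K i • a := by
  fin_cases i
  · change a ∈ 𝒜 0 at ha
    change _ = sgn K 0 • _
    rw [parity, LinearMap.sub_apply, proj_of_mem 𝒜 ha, proj_of_mem_ne 𝒜 ha (by decide), sgn_zero,
      sub_zero, one_smul]
  · change a ∈ 𝒜 1 at ha
    change _ = sgn K 1 • _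
    rw [parity, LinearMap.sub_apply, proj_of_mem 𝒜 ha, proj_of_mem_ne 𝒜 ha (by decide), sgn_one,
      zero_sub, neg_smul, one_smul]

variable (𝒜) in
/-- The family of operators `ψ`, where the odd ones are preceded by the operator `σ`. -/
def koszul (σ : Module.End K M) (ψ : A →ₗ[K] Module.End K M) : A →ₗ[K] Module.End K M :=
  ψ ∘ₗ GradedAlgebra.proj 𝒜 0 + LinearMap.mulRight K σ ∘ₗ ψ ∘ₗ GradedAlgebra.proj 𝒜 1

theorem koszul_apply {σ : Module.End K M} {ψ : A →ₗ[K] Module.End K M} {i k : ZMod 2} {a : A}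
    (ha : a ∈ 𝒜 i) {v : M} (hv : σ v = sgn K k • v) :
    koszul 𝒜 σ ψ a v = sgn K (i * k) • ψ a v := by
  fin_cases i
  · change a ∈ 𝒜 0 at ha
    change _ = sgn K (0 * k) • _
    simp [koszul, proj_of_mem 𝒜 ha, proj_of_mem_ne 𝒜 ha (show (0 : ZMod 2) ≠ 1 by decide)]
  · change a ∈ 𝒜 1 at ha
    change _ = sgn K (1 * k) • _
    simp [koszul, proj_of_mem 𝒜 ha, proj_of_mem_ne 𝒜 ha (show (1 : ZMod 2) ≠ 0 by decide), hv]

theorem linearMap_ext_homogeneous {T T' : A ⊗[K] A →ₗ[K] M}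
    (h : ∀ k l, ∀ q ∈ 𝒜 k, ∀ x ∈ 𝒜 l, T (q ⊗ₜ x) = T' (q ⊗ₜ x)) : T = T' := by
  refine TensorProduct.ext' fun q x => ?_
  induction q using homogeneous_induction (𝒜 := 𝒜) with
  | hadd q q' hq hq' => simp only [TensorProduct.add_tmul, map_add, hq, hq']
  | h k q hq =>
    induction x using homogeneous_induction (𝒜 := 𝒜) with
    | hadd x x' hx hx' => simp only [TensorProduct.tmul_add, map_add, hx, hx']
    | h l x hx => exact h k l q hq x hx

theorem map_mul_of_homogeneous {E : Type*} [Ring E] [Algebra K E] {f : A →ₗ[K] E}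
    (h : ∀ i j, ∀ a ∈ 𝒜 i, ∀ b ∈ 𝒜 j, f (a * b) = f a * f b) (a b : A) :
    f (a * b) = f a * f b := by
  induction a using homogeneous_induction (𝒜 := 𝒜) with
  | hadd x y hx hy => simp only [add_mul, map_add, hx, hy]
  | h i a ha =>
    induction b using homogeneous_induction (𝒜 := 𝒜) with
    | hadd x y hx hy => simp only [mul_add, map_add, hx, hy]
    | h j b hb => exact h i j a ha b hb

end Koszul

end SuperTensor

namespace QuasiHopfSuperalgebra

open SuperTensor GradedTensorProduct

variable {K A : Type*} [Field K] [Ring A] [Algebra K A]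
variable {𝒜 : ZMod 2 → Submodule K A} [GradedAlgebra 𝒜]

theorem S_mul' (H : QuasiHopfSuperalgebra 𝒜) {i j : ZMod 2} {a b : A} (ha : a ∈ 𝒜 i)
    (hb : b ∈ 𝒜 j) : H.S (a * b) = sgn K (i * j) • (H.S b * H.S a) := by
  rw [H.S_mul i j a ha b hb, unit_smul_eq_sgn (K := K)]

/-- If β were odd, ε(β) would vanish and ε applied to ∑ S(X) α Y β S(Z) = 1 would give 0 = 1. -/
theorem β_mem_even (H : QuasiHopfSuperalgebra 𝒜) : H.β ∈ 𝒜 0 := by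
  obtain ⟨i, hi⟩ := H.β_homogeneous
  fin_cases i
  · exact hi
  · have h0 : ∀ t : Tensor₃ 𝒜, H.ε (contract 𝒜 (grading₂ 𝒜) (LinearMap.mulRight K H.α ∘ₗ H.S)
        (contractS' 𝒜 H.S H.β) t) = 0 := fun t => by
      induction t using tensor₃_induction with
      | hadd x y hx hy => rw [map_add, map_add, hx, hy, add_zero]
      | h a b c => simp [contractS', H.ε_odd H.β hi]
    have h1 := h0 H.Φ
    rw [H.antipode_Φ, map_one] at h1
    exact absurd h1 one_ne_zero

theorem S_mul_β (H : QuasiHopfSuperalgebra 𝒜) (a : A) : H.S (a * H.β) = H.S H.β * H.S a := by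
  induction a using homogeneous_induction (𝒜 := 𝒜) with
  | hadd x y hx hy => simp only [add_mul, mul_add, map_add, hx, hy]
  | h i a ha => rw [H.S_mul' ha H.β_mem_even, mul_zero, sgn_zero, one_smul]

theorem S_β_mul (H : QuasiHopfSuperalgebra 𝒜) (a : A) : H.S (H.β * a) = H.S a * H.S H.β := by
  induction a using homogeneous_induction (𝒜 := 𝒜) with
  | hadd x y hx hy => simp only [add_mul, mul_add, map_add, hx, hy]
  | h i a ha => rw [H.S_mul' H.β_mem_even ha, zero_mul, sgn_zero, one_smul]

theorem contractS'_mem (H : QuasiHopfSuperalgebra 𝒜) {n : ZMod 2} {t : Tensor₂ 𝒜}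
    (ht : t ∈ grading₂ 𝒜 n) : contractS' 𝒜 H.S H.β t ∈ 𝒜 n := by
  induction ht using Submodule.span_induction with
  | mem x hx =>
    obtain ⟨i, j, rfl, a, ha, b, hb, rfl⟩ := hx
    have := SetLike.mul_mem_graded ha
      (SetLike.mul_mem_graded H.β_mem_even (H.S_mem j b hb))
    rwa [zero_add] at this
  | zero => rw [map_zero]; exact zero_mem _
  | add x y _ _ hx hy => rw [map_add]; exact add_mem hx hy
  | smul r x _ hx => rw [map_smul]; exact Submodule.smul_mem _ _ hx

/-! ### Four supercommuting actions of `A` on `A ⊗ A`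

On `q ⊗ x` these are, up to the Koszul sign, `q ⊗ a x`, `a q ⊗ x`, `q S(a) ⊗ x` and `q ⊗ x S(a)`. -/

variable (H : QuasiHopfSuperalgebra 𝒜)

/-- The action `q ⊗ x ↦ (-1)^([a][q]) q ⊗ a x`. -/
def legP (_ : QuasiHopfSuperalgebra 𝒜) : A →ₗ[K] Module.End K (A ⊗[K] A) :=
  koszul 𝒜 (LinearMap.rTensor A (parity 𝒜)) (LinearMap.lTensorHom A ∘ₗ LinearMap.mul K A)

/-- The action `q ⊗ x ↦ a q ⊗ x`. -/
def legQ (_ : QuasiHopfSuperalgebra 𝒜) : A →ₗ[K] Module.End K (A ⊗[K] A) :=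
  LinearMap.rTensorHom A ∘ₗ LinearMap.mul K A

/-- The action `q ⊗ x ↦ (-1)^([a][q]) q S(a) ⊗ x`. -/
def legQ' : A →ₗ[K] Module.End K (A ⊗[K] A) :=
  koszul 𝒜 (LinearMap.rTensor A (parity 𝒜))
    (LinearMap.rTensorHom A ∘ₗ (LinearMap.mul K A).flip ∘ₗ H.S)

/-- The action `q ⊗ x ↦ (-1)^([a]([q] + [x])) q ⊗ x S(a)`. -/
def legP' : A →ₗ[K] Module.End K (A ⊗[K] A) :=
  koszul 𝒜 (TensorProduct.map (parity 𝒜) (parity 𝒜))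
    (LinearMap.lTensorHom A ∘ₗ (LinearMap.mul K A).flip ∘ₗ H.S)

/-- `q ⊗ x ↦ S(q) α x`. -/
def evalα : A ⊗[K] A →ₗ[K] A :=
  LinearMap.mul' K A ∘ₗ TensorProduct.map H.S (LinearMap.mulLeft K H.α)

theorem evalα_tmul (q x : A) : H.evalα (q ⊗ₜ x) = H.S q * (H.α * x) := rfl

theorem legQ_tmul (a q x : A) : H.legQ a (q ⊗ₜ x) = (a * q) ⊗ₜ x := rfl

theorem legP_tmul {i k : ZMod 2} {a q : A} (ha : a ∈ 𝒜 i) (hq : q ∈ 𝒜 k) (x : A) :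
    H.legP a (q ⊗ₜ x) = sgn K (i * k) • (q ⊗ₜ (a * x)) :=
  koszul_apply ha (by rw [LinearMap.rTensor_tmul, parity_of_mem hq, TensorProduct.smul_tmul'])

theorem legQ'_tmul {i k : ZMod 2} {a q : A} (ha : a ∈ 𝒜 i) (hq : q ∈ 𝒜 k) (x : A) :
    H.legQ' a (q ⊗ₜ x) = sgn K (i * k) • ((q * H.S a) ⊗ₜ x) :=
  koszul_apply ha (by rw [LinearMap.rTensor_tmul, parity_of_mem hq, TensorProduct.smul_tmul'])

theorem legP'_tmul {i k l : ZMod 2} {a q x : A} (ha : a ∈ 𝒜 i) (hq : q ∈ 𝒜 k) (hx : x ∈ 𝒜 l) :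
    H.legP' a (q ⊗ₜ x) = sgn K (i * (k + l)) • (q ⊗ₜ (x * H.S a)) :=
  koszul_apply ha (by
    rw [TensorProduct.map_tmul, parity_of_mem hq, parity_of_mem hx, TensorProduct.smul_tmul_smul,
      sgn_mul_sgn])

theorem one_mem_even (𝒜 : ZMod 2 → Submodule K A) [GradedAlgebra 𝒜] : (1 : A) ∈ 𝒜 0 :=
  SetLike.GradedOne.one_mem

theorem legP_one : H.legP 1 = 1 := linearMap_ext_homogeneous (𝒜 := 𝒜) fun k l q hq x hx => by
  rw [H.legP_tmul (one_mem_even 𝒜) hq, zero_mul, sgn_zero, one_smul, one_mul]; rfl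

theorem legQ_one : H.legQ 1 = 1 := linearMap_ext_homogeneous (𝒜 := 𝒜) fun k l q hq x hx => by
  rw [H.legQ_tmul, one_mul]; rfl

theorem legQ'_one : H.legQ' 1 = 1 := linearMap_ext_homogeneous (𝒜 := 𝒜) fun k l q hq x hx => by
  rw [H.legQ'_tmul (one_mem_even 𝒜) hq, zero_mul, sgn_zero, one_smul, H.S_one, mul_one]; rfl

theorem legP'_one : H.legP' 1 = 1 := linearMap_ext_homogeneous (𝒜 := 𝒜) fun k l q hq x hx => by
  rw [H.legP'_tmul (one_mem_even 𝒜) hq hx, zero_mul, sgn_zero, one_smul, H.S_one, mul_one]; rfl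

theorem legP_mul : ∀ a b, H.legP (a * b) = H.legP a * H.legP b :=
  map_mul_of_homogeneous (𝒜 := 𝒜) fun i j a ha b hb =>
    linearMap_ext_homogeneous (𝒜 := 𝒜) fun k l q hq x hx => by
      rw [Module.End.mul_apply, H.legP_tmul hb hq, map_smul, H.legP_tmul ha hq,
        H.legP_tmul (SetLike.mul_mem_graded ha hb) hq, sgn_smul_smul, mul_assoc]
      congr 2
      -- Only an identity between degrees in ℤ/2 remains, checked case by case.
      clear ha hb hq hx
      decide +revert

theorem legQ_mul (a b : A) : H.legQ (a * b) = H.legQ a * H.legQ b :=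
  linearMap_ext_homogeneous (𝒜 := 𝒜) fun k l q hq x hx => by
    rw [Module.End.mul_apply, legQ_tmul, legQ_tmul, legQ_tmul, mul_assoc]

theorem legQ'_mul : ∀ a b, H.legQ' (a * b) = H.legQ' a * H.legQ' b :=
  map_mul_of_homogeneous (𝒜 := 𝒜) fun i j a ha b hb =>
    linearMap_ext_homogeneous (𝒜 := 𝒜) fun k l q hq x hx => by
      rw [Module.End.mul_apply, H.legQ'_tmul hb hq, map_smul,
        H.legQ'_tmul ha (SetLike.mul_mem_graded hq (H.S_mem j b hb)),
        H.legQ'_tmul (SetLike.mul_mem_graded ha hb) hq, sgn_smul_smul, H.S_mul' ha hb,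
        mul_smul_comm, TensorProduct.smul_tmul', sgn_smul_smul, mul_assoc]
      congr 3
      clear ha hb hq hx
      decide +revert

theorem legP'_mul : ∀ a b, H.legP' (a * b) = H.legP' a * H.legP' b :=
  map_mul_of_homogeneous (𝒜 := 𝒜) fun i j a ha b hb =>
    linearMap_ext_homogeneous (𝒜 := 𝒜) fun k l q hq x hx => by
      rw [Module.End.mul_apply, H.legP'_tmul hb hq hx, map_smul,
        H.legP'_tmul ha hq (SetLike.mul_mem_graded hx (H.S_mem j b hb)),
        H.legP'_tmul (SetLike.mul_mem_graded ha hb) hq hx, sgn_smul_smul, H.S_mul' ha hb,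
        mul_smul_comm, TensorProduct.tmul_smul, sgn_smul_smul, mul_assoc]
      congr 2
      clear ha hb hq hx
      decide +revert

theorem legP_legQ : SuperCommute 𝒜 𝒜 H.legP H.legQ where
  left_one := H.legP_one
  left_mul := H.legP_mul
  right_one := H.legQ_one
  right_mul := H.legQ_mul
  comm i j a ha b hb := linearMap_ext_homogeneous (𝒜 := 𝒜) fun k l q hq x hx => by
    rw [LinearMap.smul_apply, Module.End.mul_apply, Module.End.mul_apply, legQ_tmul,
      H.legP_tmul ha (SetLike.mul_mem_graded hb hq), H.legP_tmul ha hq, map_smul, legQ_tmul,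
      sgn_smul_smul, mul_add]

theorem legP_legQ' : SuperCommute 𝒜 𝒜 H.legP H.legQ' where
  left_one := H.legP_one
  left_mul := H.legP_mul
  right_one := H.legQ'_one
  right_mul := H.legQ'_mul
  comm i j a ha b hb := linearMap_ext_homogeneous (𝒜 := 𝒜) fun k l q hq x hx => by
    rw [LinearMap.smul_apply, Module.End.mul_apply, Module.End.mul_apply, H.legQ'_tmul hb hq,
      map_smul, H.legP_tmul ha (SetLike.mul_mem_graded hq (H.S_mem j b hb)), H.legP_tmul ha hq,
      map_smul, H.legQ'_tmul hb hq]
    simp only [sgn_smul_smul]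
    congr 2
    ring

theorem legP_legP' : SuperCommute 𝒜 𝒜 H.legP H.legP' where
  left_one := H.legP_one
  left_mul := H.legP_mul
  right_one := H.legP'_one
  right_mul := H.legP'_mul
  comm i j a ha b hb := linearMap_ext_homogeneous (𝒜 := 𝒜) fun k l q hq x hx => by
    rw [LinearMap.smul_apply, Module.End.mul_apply, Module.End.mul_apply, H.legP'_tmul hb hq hx,
      map_smul, H.legP_tmul ha hq, H.legP_tmul ha hq, map_smul,
      H.legP'_tmul hb hq (SetLike.mul_mem_graded ha hx), mul_assoc]
    simp only [sgn_smul_smul]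
    congr 2
    clear ha hb hq hx
    decide +revert

theorem legQ_legQ' : SuperCommute 𝒜 𝒜 H.legQ H.legQ' where
  left_one := H.legQ_one
  left_mul := H.legQ_mul
  right_one := H.legQ'_one
  right_mul := H.legQ'_mul
  comm i j a ha b hb := linearMap_ext_homogeneous (𝒜 := 𝒜) fun k l q hq x hx => by
    rw [LinearMap.smul_apply, Module.End.mul_apply, Module.End.mul_apply, H.legQ'_tmul hb hq,
      map_smul, H.legQ_tmul, H.legQ_tmul, H.legQ'_tmul hb (SetLike.mul_mem_graded ha hq),
      mul_assoc]
    simp only [sgn_smul_smul]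
    congr 2
    clear ha hb hq hx
    decide +revert

theorem legQ_legP' : SuperCommute 𝒜 𝒜 H.legQ H.legP' where
  left_one := H.legQ_one
  left_mul := H.legQ_mul
  right_one := H.legP'_one
  right_mul := H.legP'_mul
  comm i j a ha b hb := linearMap_ext_homogeneous (𝒜 := 𝒜) fun k l q hq x hx => by
    rw [LinearMap.smul_apply, Module.End.mul_apply, Module.End.mul_apply, H.legP'_tmul hb hq hx,
      map_smul, H.legQ_tmul, H.legQ_tmul, H.legP'_tmul hb (SetLike.mul_mem_graded ha hq) hx]
    simp only [sgn_smul_smul]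
    congr 2
    clear ha hb hq hx
    decide +revert

theorem legQ'_legP' : SuperCommute 𝒜 𝒜 H.legQ' H.legP' where
  left_one := H.legQ'_one
  left_mul := H.legQ'_mul
  right_one := H.legP'_one
  right_mul := H.legP'_mul
  comm i j a ha b hb := linearMap_ext_homogeneous (𝒜 := 𝒜) fun k l q hq x hx => by
    rw [LinearMap.smul_apply, Module.End.mul_apply, Module.End.mul_apply, H.legP'_tmul hb hq hx,
      map_smul, H.legQ'_tmul ha hq, H.legQ'_tmul ha hq, map_smul,
      H.legP'_tmul hb (SetLike.mul_mem_graded hq (H.S_mem i a ha)) hx]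
    simp only [sgn_smul_smul]
    congr 2
    clear ha hb hq hx
    decide +revert

/-! ### Absorption of co-products -/

theorem contract_legQ_legQ' (t : Tensor₂ 𝒜) (c : A) :
    contract 𝒜 𝒜 H.legQ H.legQ' t (H.β ⊗ₜ c) = contractS' 𝒜 H.S H.β t ⊗ₜ c := by
  induction t using homogeneous_tmul_induction with
  | hadd x y hx hy => rw [map_add, map_add, LinearMap.add_apply, hx, hy, TensorProduct.add_tmul]
  | h i j a ha b hb =>
    rw [contract_tmul, Module.End.mul_apply, H.legQ'_tmul hb H.β_mem_even, mul_zero, sgn_zero,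
      one_smul, legQ_tmul]
    rfl

theorem contract_legP_legP' (t : Tensor₂ 𝒜) :
    contract 𝒜 𝒜 H.legP H.legP' t (H.β ⊗ₜ H.β) = H.β ⊗ₜ contractS' 𝒜 H.S H.β t := by
  induction t using homogeneous_tmul_induction with
  | hadd x y hx hy => rw [map_add, map_add, LinearMap.add_apply, hx, hy, TensorProduct.tmul_add]
  | h i j a ha b hb =>
    rw [contract_tmul, Module.End.mul_apply, H.legP'_tmul hb H.β_mem_even H.β_mem_even, add_zero,
      mul_zero, sgn_zero, one_smul, H.legP_tmul ha H.β_mem_even, mul_zero, sgn_zero, one_smul]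
    rfl

/-- S reverses aq, which puts S(a) next to α and exposes the sum in the axiom for α. -/
theorem evalα_contract_legQ_legP {i k : ZMod 2} {t : Tensor₂ 𝒜} (ht : t ∈ grading₂ 𝒜 i) {q : A}
    (hq : q ∈ 𝒜 k) (x : A) : H.evalα (contract 𝒜 𝒜 H.legQ H.legP t (q ⊗ₜ x)) =
      sgn K (i * k) • (H.S q * (contractS 𝒜 H.S H.α t * x)) := by
  induction ht using Submodule.span_induction with
  | mem y hy =>
    obtain ⟨m, n, rfl, a, ha, b, hb, rfl⟩ := hy
    rw [contract_tmul, Module.End.mul_apply, H.legP_tmul hb hq, map_smul, legQ_tmul, map_smul,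
      evalα_tmul, H.S_mul' ha hq, smul_mul_assoc, sgn_smul_smul, add_mul, add_comm]
    simp only [contractS, contract_tmul, LinearMap.mulLeft_apply, mul_assoc]
  | zero => simp
  | add y z _ _ hy hz =>
    simp only [map_add, LinearMap.add_apply, hy, hz, add_mul, mul_add, smul_add]
  | smul r y _ hy =>
    simp only [map_smul, LinearMap.smul_apply, hy, smul_mul_assoc, mul_smul_comm]
    rw [smul_comm]

/-- The functional `T ↦ evalα (T (β ⊗ c))` on operators. -/
def evalAt (c : A) : Module.End K (A ⊗[K] A) →ₗ[K] A :=
  H.evalα ∘ₗ LinearMap.applyₗ (H.β ⊗ₜ c)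

theorem evalAt_apply (c : A) (T : Module.End K (A ⊗[K] A)) :
    H.evalAt c T = H.evalα (T (H.β ⊗ₜ c)) := rfl

theorem counitLeg_end_apply (a : A) (v : A ⊗[K] A) :
    H.counitLeg (Module.End K (A ⊗[K] A)) a v = H.ε a • v := rfl

theorem evalAt_mul_comulLeg_legQ (c : A) (T : Module.End K (A ⊗[K] A)) (a : A) :
    H.evalAt c (T * H.comulLeg H.legQ H.legQ' a) = H.evalAt c (T * H.counitLeg _ a) := by
  rw [evalAt_apply, evalAt_apply, Module.End.mul_apply, Module.End.mul_apply, counitLeg_end_apply,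
    comulLeg, LinearMap.comp_apply, contract_legQ_legQ', AlgHom.toLinearMap_apply, H.antipode_β,
    TensorProduct.smul_tmul']

theorem evalAt_mul_comulLeg_legP (T : Module.End K (A ⊗[K] A)) (a : A) :
    H.evalAt H.β (T * H.comulLeg H.legP H.legP' a) = H.evalAt H.β (T * H.counitLeg _ a) := by
  rw [evalAt_apply, evalAt_apply, Module.End.mul_apply, Module.End.mul_apply, counitLeg_end_apply,
    comulLeg, LinearMap.comp_apply, contract_legP_legP', AlgHom.toLinearMap_apply, H.antipode_β,
    TensorProduct.tmul_smul]

theorem evalα_comp_comulLeg (a : A) :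
    H.evalα ∘ₗ H.comulLeg H.legQ H.legP a = H.ε a • H.evalα := by
  induction a using homogeneous_induction (𝒜 := 𝒜) with
  | hadd x y hx hy => rw [map_add, LinearMap.comp_add, hx, hy, map_add, add_smul]
  | h i a ha =>
    refine linearMap_ext_homogeneous (𝒜 := 𝒜) fun k l q hq x hx => ?_
    rw [LinearMap.comp_apply, comulLeg, LinearMap.comp_apply, AlgHom.toLinearMap_apply,
      H.evalα_contract_legQ_legP (H.Δ_mem i a ha) hq, H.antipode_α,
      LinearMap.smul_apply, evalα_tmul, smul_mul_assoc, mul_smul_comm]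
    -- The sign matters only for odd a, and there ε(a) = 0.
    fin_cases i
    · change sgn K (0 * k) • _ = _
      rw [zero_mul, sgn_zero, one_smul]
    · rw [H.ε_odd a ha, zero_smul, smul_zero]

theorem evalAt_comulLeg_mul (c a : A) (T : Module.End K (A ⊗[K] A)) :
    H.evalAt c (H.comulLeg H.legQ H.legP a * T) = H.evalAt c (H.counitLeg _ a * T) := by
  rw [evalAt_apply, evalAt_apply, Module.End.mul_apply, Module.End.mul_apply, counitLeg_end_apply,
    map_smul]
  exact LinearMap.congr_fun (H.evalα_comp_comulLeg a) _

end QuasiHopfSuperalgebra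

namespace QuasiHopfSuperalgebra

open SuperTensor GradedTensorProduct

variable {K A : Type*} [Field K] [Ring A] [Algebra K A]
variable {𝒜 : ZMod 2 → Submodule K A} [GradedAlgebra 𝒜]
variable (H : QuasiHopfSuperalgebra 𝒜) {R : (Tensor₂ 𝒜)ˣ}

/-! ### Evaluation of the operators -/

theorem evalα_contract_legP_legQ {t : Tensor₂ 𝒜} (ht : t ∈ grading₂ 𝒜 0) (q x : A) :
    H.evalα (contract 𝒜 𝒜 H.legP H.legQ t (q ⊗ₜ x)) =
      H.S q * (contractOp 𝒜 𝒜 (LinearMap.mulLeft K H.α ∘ₗ parity 𝒜) H.S t * x) := by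
  induction q using homogeneous_induction (𝒜 := 𝒜) with
  | hadd q q' hq hq' => simp only [TensorProduct.add_tmul, map_add, add_mul, hq, hq']
  | h k q hq =>
    induction ht using Submodule.span_induction with
    | mem y hy =>
      obtain ⟨i, j, hij, a, ha, b, hb, rfl⟩ := hy
      rw [contract_tmul, Module.End.mul_apply, legQ_tmul,
        H.legP_tmul ha (SetLike.mul_mem_graded hb hq), map_smul, evalα_tmul, H.S_mul' hb hq,
        contractOp_tmul, LinearMap.comp_apply, parity_of_mem ha, LinearMap.mulLeft_apply]
      simp only [mul_smul_comm, smul_mul_assoc, sgn_smul_smul, mul_assoc]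
      -- Evenness of the tensor forces i = j; the signs involving k cancel, and the parity in
      -- `uCore` is what remains.
      congr 2
      clear ha hb hq
      decide +revert
    | zero => simp
    | add y z _ _ hy hz => simp only [map_add, LinearMap.add_apply, hy, hz, add_mul, mul_add]
    | smul r y _ hy => simp only [map_smul, LinearMap.smul_apply, hy, smul_mul_assoc, mul_smul_comm]

theorem evalα_legR_contract₃ (hR : H.IsUniversalRMatrix R) {t : Tensor₃ 𝒜}
    (ht : t ∈ grading₃ 𝒜 0) :
    H.evalα (legR R H.legP H.legQ (contract₃ 𝒜 H.legP H.legQ H.legQ' t (H.β ⊗ₜ 1))) =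
      contractOp 𝒜 (grading₂ 𝒜) (LinearMap.mulLeft K (H.uCore R) ∘ₗ parity 𝒜)
        (H.S ∘ₗ contractS' 𝒜 H.S H.β) t := by
  induction ht using Submodule.span_induction with
  | mem y hy =>
    obtain ⟨i, j, hij, a, ha, v, hv, rfl⟩ := hy
    rw [contract₃, contract_tmul, Module.End.mul_apply, contract_legQ_legQ',
      H.legP_tmul ha (H.contractS'_mem hv), map_smul, map_smul, legR,
      H.evalα_contract_legP_legQ hR.mem_even, contractOp_tmul, LinearMap.comp_apply,
      LinearMap.comp_apply, parity_of_mem ha, LinearMap.mulLeft_apply, mul_one]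
    simp only [mul_smul_comm]
    -- From i + j = 0 in ℤ/2, i = j and i * i = i: the Koszul sign is the factor (-1)^[X] in u.
    have : i * j = i := by clear ha hv; decide +revert
    rw [this]
    rfl
  | zero => simp
  | add y z _ _ hy hz => simp only [map_add, LinearMap.add_apply, hy, hz]
  | smul r y _ hy => simp only [map_smul, LinearMap.smul_apply, hy]

theorem u_eq_evalAt (hR : H.IsUniversalRMatrix R) :
    H.u R = H.evalAt 1 (legR R H.legP H.legQ * H.legΦ H.legP H.legQ H.legQ') :=
  (H.evalα_legR_contract₃ hR H.Φ_mem_even).symm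

theorem contract₃_legQ_legP_legP' (t : Tensor₃ 𝒜) :
    contract₃ 𝒜 H.legQ H.legP H.legP' t (H.β ⊗ₜ H.β) =
      TensorProduct.map (LinearMap.mulRight K H.β) (contractS' 𝒜 H.S H.β)
        ((of K 𝒜 (grading₂ 𝒜)).symm t) := by
  induction t using tmul_induction with
  | hadd x y hx hy => simp only [map_add, LinearMap.add_apply, hx, hy]
  | h a v =>
    rw [contract₃, contract_tmul, Module.End.mul_apply, contract_legP_legP', legQ_tmul]
    rfl

/-- S(Xβ) = S(β)S(X) lets S(β) be pulled out on the left, leaving ∑ S(X) α Y β S(Z) = 1. -/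
theorem evalα_legΦ : H.evalα (H.legΦ H.legQ H.legP H.legP' (H.β ⊗ₜ H.β)) = H.S H.β := by
  have h1 : ∀ t : Tensor₃ 𝒜, H.evalα (contract₃ 𝒜 H.legQ H.legP H.legP' t (H.β ⊗ₜ H.β)) =
      H.S H.β * contract 𝒜 (grading₂ 𝒜) (LinearMap.mulRight K H.α ∘ₗ H.S)
        (contractS' 𝒜 H.S H.β) t := fun t => by
    rw [contract₃_legQ_legP_legP']
    induction t using tmul_induction with
    | hadd x y hx hy => simp only [map_add, mul_add, hx, hy]
    | h a v =>
      rw [of_symm_of, TensorProduct.map_tmul, evalα_tmul, LinearMap.mulRight_apply, S_mul_β,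
        contract_tmul, LinearMap.comp_apply, LinearMap.mulRight_apply]
      simp only [mul_assoc]
  rw [legΦ, h1, H.antipode_Φ, mul_one]

/-- Through `evalα`, the two right actions become outer multiplications, by S²(b) on the left and
S(a) on the right. Evenness of `t` removes the signs coming from its components. -/
theorem evalα_legP'_legQ' {i j : ZMod 2} {a b : A} (ha : a ∈ 𝒜 i) (hb : b ∈ 𝒜 j) {t : Tensor₃ 𝒜}
    (ht : t ∈ grading₃ 𝒜 0) :
    H.evalα (H.legP' a (H.legQ' b (contract₃ 𝒜 H.legQ H.legP H.legP' t (H.β ⊗ₜ H.β)))) =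
      sgn K (i * j) • (H.S (H.S b) *
        H.evalα (contract₃ 𝒜 H.legQ H.legP H.legP' t (H.β ⊗ₜ H.β)) * H.S a) := by
  rw [contract₃_legQ_legP_legP']
  induction ht using Submodule.span_induction with
  | mem y hy =>
    obtain ⟨k, l, hkl, q, hq, v, hv, rfl⟩ := hy
    have hqβ : q * H.β ∈ 𝒜 k := by
      have := SetLike.mul_mem_graded hq H.β_mem_even
      rwa [add_zero] at this
    rw [of_symm_of, TensorProduct.map_tmul, LinearMap.mulRight_apply, H.legQ'_tmul hb hqβ,
      map_smul, map_smul,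
      H.legP'_tmul ha (SetLike.mul_mem_graded hqβ (H.S_mem j b hb)) (H.contractS'_mem hv),
      map_smul, evalα_tmul, H.S_mul' hqβ (H.S_mem j b hb), evalα_tmul]
    simp only [smul_mul_assoc, sgn_smul_smul, mul_assoc]
    congr 2
    clear hqβ ha hb hq hv
    decide +revert
  | zero => simp
  | add y z _ _ hy hz => simp only [map_add, hy, hz, mul_add, add_mul, smul_add]
  | smul r y _ hy =>
    simp only [map_smul, hy, mul_smul_comm, smul_mul_assoc]
    rw [smul_comm]

/-- Up to sign, S²(b) S(β) S(a) is S(a β S(b)). -/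
theorem evalα_legR_legΦ (t : Tensor₂ 𝒜) :
    H.evalα (contract 𝒜 𝒜 H.legP' H.legQ' t
      (H.legΦ H.legQ H.legP H.legP' (H.β ⊗ₜ H.β))) = H.S (contractS' 𝒜 H.S H.β t) := by
  induction t using homogeneous_tmul_induction with
  | hadd x y hx hy => simp only [map_add, LinearMap.add_apply, hx, hy]
  | h i j a ha b hb =>
    have h1 := H.evalα_legP'_legQ' ha hb H.Φ_mem_even
    have hβb : H.β * H.S b ∈ 𝒜 j := by
      have := SetLike.mul_mem_graded H.β_mem_even (H.S_mem j b hb)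
      rwa [zero_add] at this
    rw [← legΦ, H.evalα_legΦ] at h1
    rw [contract_tmul, Module.End.mul_apply, h1]
    change _ = H.S (a * (H.β * H.S b))
    rw [H.S_mul' ha hβb, S_β_mul]

theorem evalα_lTensor_mulRight (c : A) (v : A ⊗[K] A) :
    H.evalα (LinearMap.lTensor A (LinearMap.mulRight K c) v) = H.evalα v * c := by
  induction v using TensorProduct.induction_on with
  | zero => simp
  | tmul q x =>
    rw [LinearMap.lTensor_tmul, evalα_tmul, evalα_tmul, LinearMap.mulRight_apply]
    simp only [mul_assoc]
  | add x y hx hy => simp only [map_add, add_mul, hx, hy]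

theorem lTensor_mulRight_mul_legP (c a : A) :
    LinearMap.lTensor A (LinearMap.mulRight K c) * H.legP a =
      H.legP a * LinearMap.lTensor A (LinearMap.mulRight K c) := by
  induction a using homogeneous_induction (𝒜 := 𝒜) with
  | hadd x y hx hy => simp only [map_add, mul_add, add_mul, hx, hy]
  | h i a ha =>
    refine linearMap_ext_homogeneous (𝒜 := 𝒜) fun k l q hq x hx => ?_
    rw [Module.End.mul_apply, Module.End.mul_apply, H.legP_tmul ha hq, map_smul,
      LinearMap.lTensor_tmul, LinearMap.lTensor_tmul, H.legP_tmul ha hq, LinearMap.mulRight_apply,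
      LinearMap.mulRight_apply, mul_assoc]

theorem lTensor_mulRight_mul_legQ (c a : A) :
    LinearMap.lTensor A (LinearMap.mulRight K c) * H.legQ a =
      H.legQ a * LinearMap.lTensor A (LinearMap.mulRight K c) :=
  TensorProduct.ext' fun _ _ => rfl

theorem lTensor_mulRight_mul_legQ' (c a : A) :
    LinearMap.lTensor A (LinearMap.mulRight K c) * H.legQ' a =
      H.legQ' a * LinearMap.lTensor A (LinearMap.mulRight K c) := by
  induction a using homogeneous_induction (𝒜 := 𝒜) with
  | hadd x y hx hy => simp only [map_add, mul_add, add_mul, hx, hy]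
  | h i a ha =>
    refine linearMap_ext_homogeneous (𝒜 := 𝒜) fun k l q hq x hx => ?_
    rw [Module.End.mul_apply, Module.End.mul_apply, H.legQ'_tmul ha hq, map_smul,
      LinearMap.lTensor_tmul, LinearMap.lTensor_tmul, H.legQ'_tmul ha hq]

/-- Used for operators built from P, Q and Q', which commute with right multiplication on the second
factor; P' itself acts by such multiplications. -/
theorem evalAt_eq_mul {T : Module.End K (A ⊗[K] A)} {c : A}
    (hT : LinearMap.lTensor A (LinearMap.mulRight K c) * T =
      T * LinearMap.lTensor A (LinearMap.mulRight K c)) :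
    H.evalAt c T = H.evalAt 1 T * c := by
  have h1 := LinearMap.congr_fun hT (H.β ⊗ₜ 1)
  rw [Module.End.mul_apply, Module.End.mul_apply, LinearMap.lTensor_tmul,
    LinearMap.mulRight_apply, one_mul] at h1
  rw [evalAt_apply, evalAt_apply, ← h1, evalα_lTensor_mulRight]

/-- The source of S²: S(q S(a)) reverses to S²(a) S(q), with a sign that cancels the one in `legQ'`.
-/
theorem evalα_legQ' (a : A) (v : A ⊗[K] A) :
    H.evalα (H.legQ' a v) = H.S (H.S a) * H.evalα v := by
  induction a using homogeneous_induction (𝒜 := 𝒜) with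
  | hadd x y hx hy => simp only [map_add, LinearMap.add_apply, add_mul, hx, hy]
  | h i a ha =>
    have : H.evalα ∘ₗ H.legQ' a = LinearMap.mulLeft K (H.S (H.S a)) ∘ₗ H.evalα := by
      refine linearMap_ext_homogeneous (𝒜 := 𝒜) fun k l q hq x hx => ?_
      rw [LinearMap.comp_apply, LinearMap.comp_apply, H.legQ'_tmul ha hq, map_smul, evalα_tmul,
        H.S_mul' hq (H.S_mem i a ha), smul_mul_assoc, sgn_smul_smul, mul_comm k i,
        CharTwo.add_self_eq_zero, sgn_zero, one_smul, LinearMap.mulLeft_apply, evalα_tmul,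
        mul_assoc]
    exact LinearMap.congr_fun this v

theorem legP_β_tmul (a x : A) : H.legP a (H.β ⊗ₜ x) = H.β ⊗ₜ (a * x) := by
  induction a using homogeneous_induction (𝒜 := 𝒜) with
  | hadd a b ha hb =>
    rw [map_add, LinearMap.add_apply, ha, hb, add_mul, TensorProduct.tmul_add]
  | h i a ha => rw [H.legP_tmul ha H.β_mem_even, mul_zero, sgn_zero, one_smul]

/-! ### The square of the antipode -/

theorem lTensor_mulRight_mul_mul_legΦ {W : Module.End K (A ⊗[K] A)} {c : A}
    (hWc : LinearMap.lTensor A (LinearMap.mulRight K c) * W =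
      W * LinearMap.lTensor A (LinearMap.mulRight K c)) :
    LinearMap.lTensor A (LinearMap.mulRight K c) * (W * H.legΦ H.legP H.legQ H.legQ') =
      W * H.legΦ H.legP H.legQ H.legQ' * LinearMap.lTensor A (LinearMap.mulRight K c) := by
  rw [← mul_assoc, hWc, mul_assoc, mul_assoc, mul_legΦ_eq (H.lTensor_mulRight_mul_legP c)
    (H.lTensor_mulRight_mul_legQ c) (H.lTensor_mulRight_mul_legQ' c)]

/-- An operator `W` that flips `Δ` gives an element implementing the square of the antipode. -/
theorem S_S_mul_evalAt {W : Module.End K (A ⊗[K] A)}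
    (hW : ∀ a, W * H.comulLeg H.legP H.legQ a = H.comulLeg H.legQ H.legP a * W)
    (hWr : ∀ a, W * H.legQ' a = H.legQ' a * W)
    (hWc : ∀ c, LinearMap.lTensor A (LinearMap.mulRight K c) * W =
      W * LinearMap.lTensor A (LinearMap.mulRight K c)) (a : A) :
    H.S (H.S a) * H.evalAt 1 (W * H.legΦ H.legP H.legQ H.legQ') =
      H.evalAt 1 (W * H.legΦ H.legP H.legQ H.legQ') * a := by
  have h1 := apply_mul_legΦ_mul_leg H.legP_legQ H.legP_legQ' H.legQ_legQ' hW hWr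
    (H.evalAt_mul_comulLeg_legQ 1) (H.evalAt_comulLeg_mul 1) a
  rw [evalAt_apply, evalAt_apply, Module.End.mul_apply, Module.End.mul_apply (H.legQ' a),
    evalα_legQ', legP_β_tmul, mul_one] at h1
  rw [← H.evalAt_eq_mul (H.lTensor_mulRight_mul_mul_legΦ (hWc a)), evalAt_apply, evalAt_apply, h1]

variable {H}

namespace IsUniversalRMatrix

theorem S_S_mul_u (hR : H.IsUniversalRMatrix R) (a : A) :
    H.S (H.S a) * H.u R = H.u R * a := by
  rw [H.u_eq_evalAt hR]
  exact H.S_S_mul_evalAt (hR.legR_mul_comulLeg H.legP_legQ)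
    (hR.commute_legR H.legP_legQ H.legP_legQ' H.legQ_legQ')
    (fun c => mul_contract_eq (H.lTensor_mulRight_mul_legP c) (H.lTensor_mulRight_mul_legQ c) _) a

/-- `S(∑ eᵢ β S(eⁱ)) = u β`. -/
theorem S_contractS'_eq (hR : H.IsUniversalRMatrix R) :
    H.S (contractS' 𝒜 H.S H.β (R : Tensor₂ 𝒜)) = H.u R * H.β := by
  have h1 := hR.apply_legR_mul_legΦ H.legP_legQ H.legP_legQ' H.legP_legP' H.legQ_legQ' H.legQ_legP'
    H.legQ'_legP' H.evalAt_mul_comulLeg_legP (H.evalAt_mul_comulLeg_legQ H.β)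
    (H.evalAt_comulLeg_mul H.β)
  have hWc : LinearMap.lTensor A (LinearMap.mulRight K H.β) * legR R H.legP H.legQ =
      legR R H.legP H.legQ * LinearMap.lTensor A (LinearMap.mulRight K H.β) :=
    mul_contract_eq (H.lTensor_mulRight_mul_legP _) (H.lTensor_mulRight_mul_legQ _) _
  rw [H.u_eq_evalAt hR, ← H.evalAt_eq_mul (H.lTensor_mulRight_mul_mul_legΦ hWc),
    ← H.evalα_legR_legΦ]
  exact h1.symm

/-- The `u`-operator `w` of the inverse of the opposite R-matrix satisfies
`w ∑ eᵢ β S(eⁱ) = S(β)`. -/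
theorem exists_mul_contractS'_eq (hR : H.IsUniversalRMatrix R) :
    ∃ w : A, (∀ a, H.S (H.S a) * w = w * a) ∧
      w * contractS' 𝒜 H.S H.β (R : Tensor₂ 𝒜) = H.S H.β := by
  have hWc : ∀ c, LinearMap.lTensor A (LinearMap.mulRight K c) * legR R⁻¹ H.legQ H.legP =
      legR R⁻¹ H.legQ H.legP * LinearMap.lTensor A (LinearMap.mulRight K c) := fun c =>
    mul_contract_eq (H.lTensor_mulRight_mul_legQ c) (H.lTensor_mulRight_mul_legP c) _
  refine ⟨H.evalAt 1 (legR R⁻¹ H.legQ H.legP * H.legΦ H.legP H.legQ H.legQ'),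
    H.S_S_mul_evalAt (hR.legR_inv_mul_comulLeg H.legP_legQ.symm)
      (hR.commute_legR_inv H.legP_legQ.symm H.legQ_legQ' H.legP_legQ') hWc, ?_⟩
  have h1 := hR.apply_legR_inv_mul_legΦ_mul_legR H.legP_legQ H.legP_legQ' H.legP_legP' H.legQ_legQ'
    H.legQ_legP' H.legQ'_legP' H.evalAt_mul_comulLeg_legP (H.evalAt_mul_comulLeg_legQ H.β)
    (H.evalAt_comulLeg_mul H.β)
  rw [evalAt_apply, evalAt_apply, evalα_legΦ, Module.End.mul_apply, legR.eq_def R,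
    contract_legP_legP'] at h1
  rw [← H.evalAt_eq_mul (H.lTensor_mulRight_mul_mul_legΦ (hWc _)), evalAt_apply, h1]

end IsUniversalRMatrix

/-! ### Invertibility of w, injectivity of S, and the conclusion. -/

theorem S_mul_β_S_mem_range {w n : A} (hw : ∀ a, H.S (H.S a) * w = w * a) (hn : w * n = H.S H.β)
    (a b : A) : ∃ c, H.S (a * (H.β * H.S b)) = w * c := by
  induction a using homogeneous_induction (𝒜 := 𝒜) with
  | hadd x y hx hy =>
    obtain ⟨c, hc⟩ := hx
    obtain ⟨d, hd⟩ := hy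
    exact ⟨c + d, by rw [add_mul, map_add, hc, hd, mul_add]⟩
  | h i a ha =>
    induction b using homogeneous_induction (𝒜 := 𝒜) with
    | hadd x y hx hy =>
      obtain ⟨c, hc⟩ := hx
      obtain ⟨d, hd⟩ := hy
      exact ⟨c + d, by rw [map_add, mul_add, mul_add, map_add, hc, hd, mul_add]⟩
    | h j b hb =>
      have hβb := SetLike.mul_mem_graded H.β_mem_even (H.S_mem j b hb)
      -- Up to sign, S(a β S(b)) = S²(b) S(β) S(a) = S²(b) w n S(a) = w b n S(a).
      refine ⟨sgn K (i * (0 + j)) • (b * n * H.S a), ?_⟩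
      rw [H.S_mul' ha hβb, S_β_mul, ← hn, ← mul_assoc (H.S (H.S b)), hw, mul_smul_comm]
      simp only [mul_assoc]

/-- 1 = S(1) is the image under S of a sum of terms a β S(b) with a = S(X) α Y, each sent into wA.
-/
theorem exists_mul_eq_one {w n : A} (hw : ∀ a, H.S (H.S a) * w = w * a)
    (hn : w * n = H.S H.β) : ∃ c, w * c = 1 := by
  have h1 : ∀ t : Tensor₃ 𝒜, ∃ c, H.S (contract 𝒜 (grading₂ 𝒜) (LinearMap.mulRight K H.α ∘ₗ H.S)
      (contractS' 𝒜 H.S H.β) t) = w * c := fun t => by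
    induction t using tensor₃_induction with
    | hadd x y hx hy =>
      obtain ⟨c, hc⟩ := hx
      obtain ⟨d, hd⟩ := hy
      exact ⟨c + d, by rw [map_add, map_add, hc, hd, mul_add]⟩
    | h x y z =>
      have h2 := S_mul_β_S_mem_range hw hn (H.S x * H.α * y) z
      rw [mul_assoc (H.S x * H.α)] at h2
      exact h2
  obtain ⟨c, hc⟩ := h1 H.Φ
  exact ⟨c, by rw [← hc, H.antipode_Φ, H.S_one]⟩

theorem IsUniversalRMatrix.S_u_mul_S_β (hR : H.IsUniversalRMatrix R) :
    H.S (H.u R) * H.S H.β = contractS' 𝒜 H.S H.β (R : Tensor₂ 𝒜) := by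
  obtain ⟨w, hw, hn⟩ := hR.exists_mul_contractS'_eq
  obtain ⟨c, hc⟩ := exists_mul_eq_one hw hn
  -- The intertwining property turns the right inverse c into a left inverse S²(c), so c = w⁻¹ and
  -- S² is conjugation by w.
  have hc' : H.S (H.S c) * w = 1 := by rw [hw, hc]
  have hSS : ∀ a, H.S (H.S a) = w * a * c := fun a => by rw [← hw, mul_assoc, hc, mul_one]
  have hcw : c * w = 1 := by rw [left_inv_eq_right_inv hc' hc] at hc'; exact hc'
  have hinj : Function.Injective H.S := fun a b hab => by
    have h1 : w * a = w * b := by rw [← hw, ← hw, hab]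
    simpa only [← mul_assoc, hcw, one_mul] using congrArg (c * ·) h1
  -- S² fixes w, so S²(w)u = uw is commutation of u and w.
  have hwu : w * H.u R = H.u R * w := by
    rw [← hR.S_S_mul_u w, hSS w, mul_assoc w, hc, mul_one]
  have huc : H.u R * c = c * H.u R := by
    calc H.u R * c = c * (w * H.u R) * c := by rw [← mul_assoc c, hcw, one_mul]
      _ = c * H.u R := by rw [hwu, mul_assoc, mul_assoc, hc, mul_one]
  apply hinj
  -- Both sides become wβw⁻¹u: one as S²(βu), the other as uβ = S²(β)u.
  rw [hR.S_contractS'_eq, ← S_β_mul, hSS, ← hR.S_S_mul_u, hSS, mul_assoc w, mul_assoc w,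
    mul_assoc w, mul_assoc, mul_assoc, huc]

end QuasiHopfSuperalgebra

end

theorem mainTheorem9 {K A : Type*} [Field K] [Ring A] [Algebra K A]
    (𝒜 : ZMod 2 → Submodule K A) [GradedAlgebra 𝒜]
    (H : QuasiHopfSuperalgebra 𝒜) (R : (SuperTensor.Tensor₂ 𝒜)ˣ) (hR : H.IsUniversalRMatrix R) :
    (∀ (n : ℕ) (e e' : Fin n → A),
        (R : SuperTensor.Tensor₂ 𝒜) = ∑ i, GradedTensorProduct.tmul K (e i) (e' i) →
          H.S (H.u R) * H.S H.β = ∑ i, e i * H.β * H.S (e' i)) ∧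
      H.S (H.u R) * H.S H.β = SuperTensor.contractS' 𝒜 H.S H.β (R : SuperTensor.Tensor₂ 𝒜) := by
  have h1 := hR.S_u_mul_S_β
  refine ⟨fun n e e' he => ?_, h1⟩
  rw [h1, he, map_sum]
  refine Finset.sum_congr rfl fun i _ => ?_
  rw [mul_assoc]
  rfl
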